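/- Fix integers $r\ge 1$ and $1\le L_{\min}\le L_{\max}$. For every $N$ let $\mathcal X=\mathcal X^{(N)}$ consist of vectors $x_1,\dots,x_N\in\mathbb R^r$ and, for each $l\in\{L_{\min},\dots,L_{\max}\}$, let the candidate model $M_l$ come with a partition of $\mathcal X$ into clusters $\mathcal X_1,\dots,\mathcal X_l$ of sizes $N_1,\dots,N_l$, and with degrees of freedom $\nu_1,\dots,\nu_l>0$ that do not depend on $N$. Let $f(x\mid\theta_m)$ be the density of the $r$-variate $t_{\nu_m}(\mu_m,\Psi_m)$ distribution, where $\theta_m\in\mathbb R^q$, $q=\tfrac12 r(r+3)$, consists of the entries of $\mu_m$ and the unique entries of the symmetric matrix $\Psi_m$, and put $$\mathcal L(\Theta_l\mid\mathcal X)=\prod_{m=1}^l\mathcal L(\theta_m\mid\mathcal X_m),\qquad \mathcal L(\theta_m\mid\mathcal X_m)=\prod_{x_n\in\mathcal X_m}\frac{N_m}{N}\,f(x_n\mid\theta_m).$$ Let $p(M_l)>0$, $\sum_l p(M_l)=1$, be prior probabilities, and let $f(\cdot\mid M_l)$ be a continuous probability density on a measurable parameter space $\Omega_l$ of parameters $\Theta_l=(\theta_1,\dots,\theta_l)$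 with positive definite scatter matrices; these priors do not depend on $N$. By Bayes' theorem the posterior probability of $M_l$ is $$p(M_l\mid\mathcal X)=\frac{p(M_l)}{f(\mathcal X)}\int_{\Omega_l}f(\Theta\mid M_l)\,\mathcal L(\Theta\mid\mathcal X)\,d\Theta,\qquad f(\mathcal X)=\sum_{l'}p(M_{l'})\int_{\Omega_{l'}}f(\Theta\mid M_{l'})\,\mathcal L(\Theta\mid\mathcal X)\,d\Theta .$$ Assume that for every $l$, as $N\to\infty$: (a) for all large $N$ the estimate $\hat\Theta_l=(\hat\theta_1,\dots,\hat\theta_l)$ is a global maximizer of $\mathcal L(\cdot\mid\mathcal X)$ over $\Omega_l$ and lies in a compact subset of the interior of $\Omega_l$, independent of $N$, on which $f(\cdot\mid M_l)>0$; (b) the observed Fisher information matrices $\hat J_m=-\partial^2\log\mathcal L(\theta_m\mid\mathcal X_m)/\partial\theta_m\partial\theta_m^\top\big|_{\theta_m=\hat\theta_m}$ satisfy, for some $\kappa>0$, $\lambda_{\min}(\hat J_m/N_m)\ge\kappa$ for all $m$ and all large $N$; (c) $\log N=o(N_m)$ for every $m$; (d) for every $m$ with $\nu_m<1$ the maximum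 is asymptotically isolated: for every $\rho>0$ there is $\kappa>0$ such that for all large $N$ and all $\Theta\in\Omega_l$ with $\|\theta_m-\hat\theta_m\|\ge\rho$ one has $\log\mathcal L(\theta_m\mid\mathcal X_m)\le\log\mathcal L(\hat\theta_m\mid\mathcal X_m)-\kappa N_m$. Let $\delta_n=(x_n-\hat\mu_m)^\top\hat\Psi_m^{-1}(x_n-\hat\mu_m)$, $w_n=(\nu_m+r)/(\nu_m+\delta_n)$ for $x_n\in\mathcal X_m$, $\epsilon_m=\max\bigl(\sum_{x_n\in\mathcal X_m}w_n^2,\;N_m\bigr)$, $$D_l=\sum_{m=1}^l N_m\log N_m-\sum_{m=1}^l\frac{N_m}{2}\log|\hat\Psi_m|+\sum_{m=1}^l N_m\log\frac{\Gamma((\nu_m+r)/2)}{\Gamma(\nu_m/2)(\pi\nu_m)^{r/2}}-\frac12\sum_{m=1}^l\sum_{x_n\in\mathcal X_m}(\nu_m+r)\log\Bigl(1+\frac{\delta_n}{\nu_m}\Bigr)$$ and $$\mathrm{BIC}_{t_\nu}(M_l)=D_l-\frac q2\sum_{m=1}^l\log\epsilon_m .$$ Then for every $l\in\{L_{\min},\dots,L_{\max}\}$,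 for all large $N$, $\log\mathcal L(\hat\Theta_l\mid\mathcal X)=D_l-N\log N$ and $p(M_l\mid\mathcal X)>0$; and, as $N\to\infty$, $$\log p(M_l\mid\mathcal X)=\mathrm{BIC}_{t_\nu}(M_l)-N\log N-\log f(\mathcal X)+O(1).$$ That is, up to the two terms $-N\log N$ and $-\log f(\mathcal X)$, which do not depend on the model, the log posterior of $M_l$ equals $\mathrm{BIC}_{t_\nu}(M_l)$ with a bounded error. -/

import Mathlib

open Filter Topology

noncomputable section

namespace TBIC

/-- Index set of the free parameters of one `r`-dimensional cluster: the `r` coordinates of the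
centroid and the `r (r + 1) / 2` unique entries of the symmetric scatter matrix (one for each
unordered pair of coordinates). -/
abbrev ParamIx (r : ℕ) : Type := Fin r ⊕ Sym2 (Fin r)

/-- The parameter vector `θ` of one cluster. -/
abbrev Param (r : ℕ) : Type := ParamIx r → ℝ

/-- The centroid `μ` of a cluster parameter. -/
def loc {r : ℕ} (θ : Param r) : Fin r → ℝ := fun i => θ (Sum.inl i)

/-- The (symmetric) scatter matrix `Ψ` of a cluster parameter. -/
def scatter {r : ℕ} (θ : Param r) : Matrix (Fin r) (Fin r) ℝ :=
  Matrix.of fun i j => θ (Sum.inr s(i, j))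

/-- Squared Mahalanobis distance `δ = (x - μ)ᵀ Ψ⁻¹ (x - μ)`. -/
def mahal {r : ℕ} (θ : Param r) (x : Fin r → ℝ) : ℝ :=
  (x - loc θ) ⬝ᵥ ((scatter θ)⁻¹.mulVec (x - loc θ))

/-- The normalizing constant `Γ((ν + r) / 2) / (Γ(ν / 2) (π ν)^(r / 2))`. -/
def tConst (r : ℕ) (ν : ℝ) : ℝ :=
  Real.Gamma ((ν + r) / 2) / (Real.Gamma (ν / 2) * (Real.pi * ν) ^ ((r : ℝ) / 2))

/-- Density of the `r`-variate `t` distribution with `ν` degrees of freedom. -/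
def tPdf {r : ℕ} (ν : ℝ) (θ : Param r) (x : Fin r → ℝ) : ℝ :=
  tConst r ν * (scatter θ).det ^ (-(1 / 2) : ℝ) * (1 + mahal θ x / ν) ^ (-((ν + r) / 2))

/-- The weight `w = (ν + r) / (ν + δ)` of a data vector. -/
def weight {r : ℕ} (ν : ℝ) (θ : Param r) (x : Fin r → ℝ) : ℝ :=
  (ν + r) / (ν + mahal θ x)

/-- The indices of the data vectors in the `m`-th cluster of the partition with labels `c`. -/
def cluster {N l : ℕ} (c : Fin N → Fin l) (m : Fin l) : Finset (Fin N) :=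
  Finset.univ.filter fun n => c n = m

/-- The number `N_m` of data vectors in the `m`-th cluster. -/
def clusterSize {N l : ℕ} (c : Fin N → Fin l) (m : Fin l) : ℕ := (cluster c m).card

/-- Likelihood of the `m`-th cluster: the product over its data vectors of `p(x_n ∈ X_m) = N_m / N`
and the `t` density of `x_n`. -/
def clusterLik {r N l : ℕ} (x : Fin N → Fin r → ℝ) (c : Fin N → Fin l) (m : Fin l) (ν : ℝ)
    (θ : Param r) : ℝ :=
  ∏ n ∈ cluster c m, ((clusterSize c m : ℝ) / (N : ℝ)) * tPdf ν θ (x n)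

/-- Likelihood `L(Θ | X)` of the partitioned data set. -/
def lik {r N l : ℕ} (x : Fin N → Fin r → ℝ) (c : Fin N → Fin l) (ν : Fin l → ℝ)
    (Θ : Fin l → Param r) : ℝ :=
  ∏ m, clusterLik x c m (ν m) (Θ m)

/-- Observed Fisher information matrix of the `m`-th cluster: minus the Hessian matrix of its
log-likelihood. -/
def fisher {r N l : ℕ} (x : Fin N → Fin r → ℝ) (c : Fin N → Fin l) (m : Fin l) (ν : ℝ)
    (θ : Param r) : Matrix (ParamIx r) (ParamIx r) ℝ :=
  Matrix.of fun a b =>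
    -(fderiv ℝ (fun η : Param r =>
        fderiv ℝ (fun ζ : Param r => Real.log (clusterLik x c m ν ζ)) η (Pi.single b 1))
      θ (Pi.single a 1))

/-- `ε = max (∑_{x_n ∈ X_m} w_n², N_m)`. -/
def eps {r N l : ℕ} (x : Fin N → Fin r → ℝ) (c : Fin N → Fin l) (m : Fin l) (ν : ℝ)
    (θ : Param r) : ℝ :=
  max (∑ n ∈ cluster c m, weight ν θ (x n) ^ 2) (clusterSize c m : ℝ)

/-- The closed-form data fidelity term. -/
def dataFidelity {r N l : ℕ} (x : Fin N → Fin r → ℝ) (c : Fin N → Fin l) (ν : Fin l → ℝ)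
    (Θ : Fin l → Param r) : ℝ :=
  (∑ m, (clusterSize c m : ℝ) * Real.log (clusterSize c m))
    - (∑ m, (clusterSize c m : ℝ) / 2 * Real.log (scatter (Θ m)).det)
    + (∑ m, (clusterSize c m : ℝ) * Real.log (tConst r (ν m)))
    - 1 / 2 * ∑ m, ∑ n ∈ cluster c m, (ν m + r) * Real.log (1 + mahal (Θ m) (x n) / ν m)

/-- The number `q = r (r + 3) / 2` of estimated parameters per cluster. -/
def numParams (r : ℕ) : ℝ := (r : ℝ) * ((r : ℝ) + 3) / 2

/-- The criterion: data fidelity minus `(q / 2) ∑_m log ε`. -/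
def bicT {r N l : ℕ} (x : Fin N → Fin r → ℝ) (c : Fin N → Fin l) (ν : Fin l → ℝ)
    (Θ : Fin l → Param r) : ℝ :=
  dataFidelity x c ν Θ - numParams r / 2 * ∑ m, Real.log (eps x c m (ν m) (Θ m))

/-- The density of the data given a candidate model: the likelihood integrated, over the parameter
space `Ω`, against the prior density `f(Θ | M)`. -/
def evidence {r N l : ℕ} (x : Fin N → Fin r → ℝ) (c : Fin N → Fin l) (ν : Fin l → ℝ)
    (Ω : Set (Fin l → Param r)) (prior : (Fin l → Param r) → ℝ) : ℝ :=
  ∫ Θ in Ω, prior Θ * lik x c ν Θ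

/-- The density `f(X) = ∑_l p(M_l) f(X | M_l)` of the data set under the family of candidate models
`M_l`, `Lmin ≤ l ≤ Lmax`. -/
def dataPdf {r N Lmin Lmax : ℕ} (p : Finset.Icc Lmin Lmax → ℝ) (x : Fin N → Fin r → ℝ)
    (c : (l : Finset.Icc Lmin Lmax) → Fin N → Fin l)
    (ν : (l : Finset.Icc Lmin Lmax) → Fin l → ℝ)
    (Ω : (l : Finset.Icc Lmin Lmax) → Set (Fin l → Param r))
    (prior : (l : Finset.Icc Lmin Lmax) → (Fin l → Param r) → ℝ) : ℝ :=
  ∑ l, p l * evidence x (c l) (ν l) (Ω l) (prior l)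

/-- The posterior probability `p(M_l | X)`, by Bayes' theorem. -/
def posterior {r N Lmin Lmax : ℕ} (p : Finset.Icc Lmin Lmax → ℝ) (x : Fin N → Fin r → ℝ)
    (c : (l : Finset.Icc Lmin Lmax) → Fin N → Fin l)
    (ν : (l : Finset.Icc Lmin Lmax) → Fin l → ℝ)
    (Ω : (l : Finset.Icc Lmin Lmax) → Set (Fin l → Param r))
    (prior : (l : Finset.Icc Lmin Lmax) → (Fin l → Param r) → ℝ)
    (l : Finset.Icc Lmin Lmax) : ℝ :=
  p l * evidence x (c l) (ν l) (Ω l) (prior l) / dataPdf p x c ν Ω prior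

end TBIC

end

/-! The argument is Laplace's method, with two-sided bounds in place of an expansion. Near the
maximizer, the drop of the log-likelihood of cluster m below its maximum lies between two positive
multiples of N_m‖h‖²; farther away it is at least a multiple of N_m. The integral against the prior
is therefore comparable to the maximal likelihood times ∏ N_m^(-q/2) (`evidence_le`, `le_evidence`),
the far region being negligible because log N = o(N_m). Since ε_m / N_m lies between 1 and ((ν_m +
r)/ν_m)², log N_m can be replaced by log ε_m at bounded cost.

Two points need an idea. The first is uniformity in N, as nothing bounds the data. Scale (x, 1) to
the unit sphere: up to a term free of θ, the log-density becomes a function `projLog` that is smooth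
in θ and in the point of the sphere, points at infinity included. By compactness its Hessian in θ is
uniformly continuous, so the Fisher information bound at the maximizer alone yields quadratic bounds
on a ball whose radius does not depend on N (`exists_sumProjLog_le`, `exists_le_sumProjLog`).

The second is the far region. Location and scatter are encoded, up to scale, in a positive definite
matrix of size r + 1. Along a curve B diag(exp(t a_k)) Bᵀ the negative log-density is an affine
function plus log-sum-exp functions with coefficients (ν - 1)/2 and (ν + r)/2, hence convex for ν ≥
1 (`exists_path_convexOn_neg_projLog`). A drop attained on a small sphere around the critical point
then persists outside it (`sumProjLog_le_of_le_dist`). For ν < 1 the isolation hypothesis supplies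
the far bound instead. -/

noncomputable section

namespace TBIC

/-! ### Second order Taylor expansion with parameters. -/

section Taylor

variable {E W : Type*} [NormedAddCommGroup E] [NormedSpace ℝ E] [NormedAddCommGroup W]
  [NormedSpace ℝ W]

/-- Regularity is wanted jointly in both variables, so that the Hessian is continuous in the data
point as well. The pair (θ, w) indexes the family of functions, and the derivative is evaluated at
its first component. -/
theorem contDiffAt_partial_fderiv {F : Type*} [NormedAddCommGroup F] [NormedSpace ℝ F]
    {L : E → W → F} {θ : E} {w : W} {m n : WithTop ℕ∞} (hmn : m + 1 ≤ n)
    (hL : ContDiffAt ℝ n (Function.uncurry L) (θ, w)) :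
    ContDiffAt ℝ m (Function.uncurry fun η v => fderiv ℝ (fun ζ => L ζ v) η) (θ, w) := by
  have h : ContDiffAt ℝ n (Function.uncurry fun (p : E × W) (η : E) => L η p.2)
      ((θ, w), θ) := by
    have : ContDiffAt ℝ n (fun q : (E × W) × E => (q.2, q.1.2)) ((θ, w), θ) := by fun_prop
    exact hL.comp ((θ, w), θ) this
  exact ContDiffAt.fderiv (f := fun (p : E × W) (η : E) => L η p.2) (g := fun p => p.1)
    (x₀ := (θ, w)) h contDiffAt_fst hmn

variable {L : E → W → ℝ}

theorem hasFDerivAt_partial {θ : E} {w : W}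
    (hL : ContDiffAt ℝ 2 (Function.uncurry L) (θ, w)) :
    HasFDerivAt (fun η => L η w) (fderiv ℝ (fun η => L η w) θ) θ := by
  have h : ContDiffAt ℝ 2 (fun η => L η w) θ :=
    hL.comp (f := fun η => (η, w)) θ (contDiffAt_id.prodMk contDiffAt_const)
  exact (h.differentiableAt (by norm_num)).hasFDerivAt

theorem hasFDerivAt_partial_fderiv {θ : E} {w : W}
    (hL : ContDiffAt ℝ 2 (Function.uncurry L) (θ, w)) :
    HasFDerivAt (fun η => fderiv ℝ (fun ζ => L ζ w) η)
      (fderiv ℝ (fun η => fderiv ℝ (fun ζ => L ζ w) η) θ) θ := by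
  have h : ContDiffAt ℝ 1 (fun η => fderiv ℝ (fun ζ => L ζ w) η) θ :=
    (contDiffAt_partial_fderiv (m := 1) (by norm_num) hL).comp (f := fun η => (η, w)) θ
      (contDiffAt_id.prodMk contDiffAt_const)
  exact (h.differentiableAt (by norm_num)).hasFDerivAt

theorem continuousOn_partial_hessian {K : Set E} {S : Set W}
    (hL : ∀ θ ∈ K, ∀ w ∈ S, ContDiffAt ℝ 2 (Function.uncurry L) (θ, w)) :
    ContinuousOn (fun p : E × W =>
      fderiv ℝ (fun η => fderiv ℝ (fun ζ => L ζ p.2) η) p.1) (K ×ˢ S) := by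
  rintro ⟨θ, w⟩ ⟨hθ, hw⟩
  have h1 := contDiffAt_partial_fderiv (m := 1) (by norm_num) (hL θ hθ w hw)
  have h2 := contDiffAt_partial_fderiv (m := 0) (by norm_num) h1
  exact h2.continuousAt.continuousWithinAt

theorem exists_bound_partial_hessian {K : Set E} {S : Set W} (hK : IsCompact K)
    (hS : IsCompact S)
    (hL : ∀ θ ∈ K, ∀ w ∈ S, ContDiffAt ℝ 2 (Function.uncurry L) (θ, w)) :
    ∃ C : ℝ, 0 < C ∧ ∀ θ ∈ K, ∀ w ∈ S,
      ‖fderiv ℝ (fun η => fderiv ℝ (fun ζ => L ζ w) η) θ‖ ≤ C := by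
  obtain ⟨C, hC⟩ := IsCompact.exists_bound_of_continuousOn (E := E →L[ℝ] E →L[ℝ] ℝ)
    (hK.prod hS) (continuousOn_partial_hessian hL)
  exact ⟨max C 1, by positivity, fun θ hθ w hw => (hC (θ, w) ⟨hθ, hw⟩).trans (le_max_left _ _)⟩

/-- Second order Taylor expansion, uniformly over a compact set of base points and of
parameters. -/
theorem exists_uniform_taylor {K K' : Set E} {S : Set W} {ρ₀ ε : ℝ} (hρ₀ : 0 < ρ₀)
    (hε : 0 < ε) (hK' : IsCompact K') (hS : IsCompact S)
    (hKK' : ∀ θ ∈ K, Metric.closedBall θ ρ₀ ⊆ K')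
    (hL : ∀ θ ∈ K', ∀ w ∈ S, ContDiffAt ℝ 2 (Function.uncurry L) (θ, w)) :
    ∃ ρ, 0 < ρ ∧ ρ ≤ ρ₀ ∧ ∀ θ ∈ K, ∀ w ∈ S, ∀ h : E, ‖h‖ ≤ ρ →
      |L (θ + h) w - L θ w - fderiv ℝ (fun η => L η w) θ h
        - 1 / 2 * fderiv ℝ (fun η => fderiv ℝ (fun ζ => L ζ w) η) θ h h| ≤ ε * ‖h‖ ^ 2 := by
  have huc := (hK'.prod hS).uniformContinuousOn_of_continuous (continuousOn_partial_hessian hL)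
  obtain ⟨δ, hδ, hδ'⟩ :=
    (Metric.uniformContinuousOn_iff (β := E →L[ℝ] E →L[ℝ] ℝ)).1 huc ε hε
  -- Halving δ turns the closed bound on ‖h‖ into the strict inequality of uniform continuity.
  refine ⟨min ρ₀ (δ / 2), by positivity, min_le_left _ _, fun θ hθ w hw h hh => ?_⟩
  have hmem : ∀ t ∈ Set.Icc (0 : ℝ) 1, θ + t • h ∈ K' := by
    intro t ht
    refine hKK' θ hθ ?_
    rw [Metric.mem_closedBall, dist_eq_norm, add_sub_cancel_left, norm_smul, Real.norm_eq_abs,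
      abs_of_nonneg ht.1]
    calc t * ‖h‖ ≤ 1 * ‖h‖ := by gcongr; exact ht.2
      _ ≤ ρ₀ := by rw [one_mul]; exact hh.trans (min_le_left _ _)
  have hθ' : θ ∈ K' := by simpa using hmem 0 (by simp)
  set D : E → E →L[ℝ] ℝ := fun η => fderiv ℝ (fun ζ => L ζ w) η with hD
  set H : E → E →L[ℝ] E →L[ℝ] ℝ := fun η => fderiv ℝ D η with hH
  have hline : ∀ t : ℝ, HasDerivAt (fun t : ℝ => θ + t • h) h t := fun t => by
    simpa using ((hasDerivAt_id t).smul_const h).const_add θ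
  have hclose : ∀ t ∈ Set.Icc (0 : ℝ) 1, |H (θ + t • h) h h - H θ h h| ≤ ε * ‖h‖ ^ 2 := by
    intro t ht
    have h1 : ‖H (θ + t • h) - H θ‖ ≤ ε := by
      have := hδ' (θ + t • h, w) ⟨hmem t ht, hw⟩ (θ, w) ⟨hθ', hw⟩ ?_
      · exact (dist_eq_norm (H (θ + t • h)) (H θ)).symm.le.trans this.le
      · rw [Prod.dist_eq, dist_self, dist_eq_norm, add_sub_cancel_left, norm_smul,
          Real.norm_eq_abs, abs_of_nonneg ht.1]
        refine max_lt ?_ hδ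
        calc t * ‖h‖ ≤ 1 * ‖h‖ := by gcongr; exact ht.2
          _ ≤ δ / 2 := by rw [one_mul]; exact hh.trans (min_le_right _ _)
          _ < δ := by linarith
    have h2 : H (θ + t • h) h h - H θ h h = (H (θ + t • h) - H θ) h h := rfl
    rw [h2, ← Real.norm_eq_abs]
    calc _ ≤ ‖H (θ + t • h) - H θ‖ * ‖h‖ * ‖h‖ := ContinuousLinearMap.le_opNorm₂ _ _ _
      _ ≤ ε * ‖h‖ * ‖h‖ := by gcongr
      _ = ε * ‖h‖ ^ 2 := by ring
  -- The mean value inequality is applied twice on the segment: to the derivative minus its linear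
  -- part, then to the function minus its quadratic part. Each time the derivative is at most ε‖h‖².
  have hu : ∀ t ∈ Set.Icc (0 : ℝ) 1,
      HasDerivAt (fun t : ℝ => D (θ + t • h) h - t * H θ h h)
        (H (θ + t • h) h h - H θ h h) t := by
    intro t ht
    have h1 := (hasFDerivAt_partial_fderiv (hL _ (hmem t ht) w hw)).comp_hasDerivAt t (hline t)
    have h2 := h1.clm_apply (hasDerivAt_const t h)
    have h3 := (hasDerivAt_id t).mul_const (H θ h h)
    refine (h2.sub h3).congr_deriv ?_
    simp [hD, hH]
  have hu' : ∀ t ∈ Set.Icc (0 : ℝ) 1,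
      |D (θ + t • h) h - t * H θ h h - D θ h| ≤ ε * ‖h‖ ^ 2 := by
    intro t ht
    have := norm_image_sub_le_of_norm_deriv_le_segment' (a := 0) (b := 1) (C := ε * ‖h‖ ^ 2)
      (fun t ht => (hu t ht).hasDerivWithinAt)
      (fun t ht => hclose t ⟨ht.1, ht.2.le⟩) t ht
    simp only [zero_smul, add_zero, zero_mul, sub_zero, Real.norm_eq_abs] at this
    refine this.trans ?_
    exact mul_le_of_le_one_right (by positivity) ht.2
  have hr : ∀ t ∈ Set.Icc (0 : ℝ) 1,
      HasDerivAt (fun t : ℝ => L (θ + t • h) w - t * D θ h - t ^ 2 / 2 * H θ h h)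
        (D (θ + t • h) h - t * H θ h h - D θ h) t := by
    intro t ht
    have h1 := (hasFDerivAt_partial (hL _ (hmem t ht) w hw)).comp_hasDerivAt t (hline t)
    have h2 := (hasDerivAt_id t).mul_const (D θ h)
    have h3 := (((hasDerivAt_id t).pow 2).div_const 2).mul_const (H θ h h)
    refine ((h1.sub h2).sub h3).congr_deriv ?_
    simp [hD]
    ring
  have := norm_image_sub_le_of_norm_deriv_le_segment_01' (C := ε * ‖h‖ ^ 2)
      (fun t ht => (hr t ht).hasDerivWithinAt)
      (fun t ht => hu' t ⟨ht.1, ht.2.le⟩)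
  simp only [zero_smul, add_zero, zero_mul, sub_zero, Real.norm_eq_abs, one_smul, one_mul,
    one_pow] at this
  refine le_trans (le_of_eq ?_) this
  congr 1
  norm_num
  ring

end Taylor

/-! ### Convexity on the line. -/

section Convex

/-- Hölder's inequality in disguise: subtracting log X and log Y from the exponents makes the terms
at x and at y sum to one each, and convexity of exp is then applied term by term. -/
theorem convexOn_log_sum_exp {ι : Type*} (s : Finset ι) (c a : ι → ℝ)
    (hc : ∀ k ∈ s, 0 ≤ c k) (hpos : ∃ k ∈ s, 0 < c k) :
    ConvexOn ℝ Set.univ fun t : ℝ => Real.log (∑ k ∈ s, c k * Real.exp (t * a k)) := by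
  have hsum : ∀ t : ℝ, 0 < ∑ k ∈ s, c k * Real.exp (t * a k) := by
    intro t
    obtain ⟨k, hk, hk'⟩ := hpos
    exact Finset.sum_pos' (fun i hi => mul_nonneg (hc i hi) (Real.exp_pos _).le)
      ⟨k, hk, mul_pos hk' (Real.exp_pos _)⟩
  refine ⟨convex_univ, fun x _ y _ p q hp hq hpq => ?_⟩
  simp only [smul_eq_mul]
  set X := ∑ k ∈ s, c k * Real.exp (x * a k) with hX
  set Y := ∑ k ∈ s, c k * Real.exp (y * a k) with hY
  rw [Real.log_le_iff_le_exp (hsum _)]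
  have key : ∀ k ∈ s, c k * Real.exp ((p * x + q * y) * a k) ≤
      Real.exp (p * Real.log X + q * Real.log Y) *
        (p * (c k * Real.exp (x * a k) / X) + q * (c k * Real.exp (y * a k) / Y)) := by
    intro k hk
    have h1 := convexOn_exp.2 (Set.mem_univ (x * a k - Real.log X))
      (Set.mem_univ (y * a k - Real.log Y)) hp hq hpq
    simp only [smul_eq_mul] at h1
    rw [Real.exp_sub, Real.exp_sub, Real.exp_log (hsum x), Real.exp_log (hsum y)] at h1
    have h2 : (p * x + q * y) * a k = (p * Real.log X + q * Real.log Y) +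
      (p * (x * a k - Real.log X) + q * (y * a k - Real.log Y)) := by ring
    rw [h2, Real.exp_add]
    calc c k * (Real.exp (p * Real.log X + q * Real.log Y) *
          Real.exp (p * (x * a k - Real.log X) + q * (y * a k - Real.log Y)))
        = Real.exp (p * Real.log X + q * Real.log Y) *
          (c k * Real.exp (p * (x * a k - Real.log X) + q * (y * a k - Real.log Y))) := by ring
      _ ≤ Real.exp (p * Real.log X + q * Real.log Y) *
          (c k * (p * (Real.exp (x * a k) / X) + q * (Real.exp (y * a k) / Y))) := by
        have := hc k hk
        gcongr
      _ = _ := by ring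
  refine (Finset.sum_le_sum key).trans (le_of_eq ?_)
  rw [← Finset.mul_sum, Finset.sum_add_distrib, ← Finset.mul_sum, ← Finset.mul_sum,
    ← Finset.sum_div, ← Finset.sum_div, ← hX, ← hY, div_self (hsum x).ne',
    div_self (hsum y).ne', mul_one, mul_one, hpq, mul_one]

/-- The slope from 0 to 1 is at least the derivative at 0, so φ 0 ≤ φ 1, and φ t lies below the
chord. -/
theorem le_of_convexOn_of_hasDerivAt_zero {φ : ℝ → ℝ} (hφ : ConvexOn ℝ Set.univ φ)
    (h0 : HasDerivAt φ 0 0) {t : ℝ} (ht0 : 0 ≤ t) (ht1 : t ≤ 1) : φ t ≤ φ 1 := by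
  have h1 := hφ.le_slope_of_hasDerivAt (Set.mem_univ 0) (Set.mem_univ 1) one_pos h0
  rw [slope_def_field] at h1
  have h2 := hφ.2 (Set.mem_univ 0) (Set.mem_univ 1) (sub_nonneg.2 ht1) ht0 (by ring)
  simp only [smul_eq_mul, mul_zero, mul_one, zero_add] at h2
  norm_num at h1
  nlinarith

end Convex

/-! ### Product Gaussian integrals. -/

section Gaussian

open MeasureTheory

variable {κ ι : Type*} [Fintype κ] [Fintype ι]

theorem integrable_prod_gaussian (b : κ → ℝ) (hb : ∀ m, 0 < b m) (c : κ → ι → ℝ) :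
    Integrable fun Θ : κ → ι → ℝ => ∏ m, ∏ a, Real.exp (-b m * (Θ m a - c m a) ^ 2) := by
  refine Integrable.fintype_prod (f := fun m (θ : ι → ℝ) =>
    ∏ a, Real.exp (-b m * (θ a - c m a) ^ 2)) fun m => ?_
  refine Integrable.fintype_prod (f := fun a (x : ℝ) =>
    Real.exp (-b m * (x - c m a) ^ 2)) fun a => ?_
  exact (integrable_exp_neg_mul_sq (hb m)).comp_sub_right (c m a)

theorem integral_prod_gaussian (b : κ → ℝ) (c : κ → ι → ℝ) :
    ∫ Θ : κ → ι → ℝ, ∏ m, ∏ a, Real.exp (-b m * (Θ m a - c m a) ^ 2) =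
      ∏ m, √(Real.pi / b m) ^ Fintype.card ι := by
  rw [integral_fintype_prod_volume_eq_prod (fun m (θ : ι → ℝ) =>
    ∏ a, Real.exp (-b m * (θ a - c m a) ^ 2))]
  refine Finset.prod_congr rfl fun m _ => ?_
  rw [integral_fintype_prod_volume_eq_prod (fun a (x : ℝ) =>
    Real.exp (-b m * (x - c m a) ^ 2)), ← Finset.card_univ, ← Finset.prod_const]
  refine Finset.prod_congr rfl fun a _ => ?_
  rw [← integral_gaussian]
  exact integral_sub_right_eq_self (fun x : ℝ => Real.exp (-b m * x ^ 2)) (c m a)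

end Gaussian

/-! ### The t density in homogeneous coordinates. -/

section Density

variable {r : ℕ} {ν : ℝ}

/-- The form `s² + (y - s μ)ᵀ Ψ⁻¹ (y - s μ) / ν` in the homogeneous coordinates `(y, s)`. -/
def projQuad (ν : ℝ) (θ : Param r) (w : (Fin r → ℝ) × ℝ) : ℝ :=
  w.2 ^ 2 + (w.1 - w.2 • loc θ) ⬝ᵥ ((scatter θ)⁻¹.mulVec (w.1 - w.2 • loc θ)) / ν

/-- The logarithm of the `t` density in homogeneous coordinates. -/
def projLog (ν : ℝ) (θ : Param r) (w : (Fin r → ℝ) × ℝ) : ℝ :=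
  Real.log (tConst r ν) - 1 / 2 * Real.log (scatter θ).det
    - (ν + r) / 2 * Real.log (projQuad ν θ w)

/-- The last homogeneous coordinate of the normalized representative of a data vector. -/
def projScale (x : Fin r → ℝ) : ℝ := (max 1 ‖x‖)⁻¹

/-- The homogeneous coordinates, of norm one, of a data vector. -/
def projPt (x : Fin r → ℝ) : (Fin r → ℝ) × ℝ := (projScale x • x, projScale x)

theorem projScale_pos (x : Fin r → ℝ) : 0 < projScale x :=
  inv_pos.2 (lt_max_of_lt_left one_pos)

/-- However large the data vectors are, their representatives stay in one compact set. The norm is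
the sup norm, which is why the scale is built from a maximum. -/
theorem norm_projPt (x : Fin r → ℝ) : ‖projPt x‖ = 1 := by
  have h := projScale_pos x
  rw [projPt, Prod.norm_mk, norm_smul, Real.norm_eq_abs, abs_of_pos h]
  have h1 : max (projScale x * ‖x‖) (projScale x) = projScale x * max 1 ‖x‖ := by
    rw [mul_max_of_nonneg _ _ h.le, mul_one, max_comm]
  rw [h1, projScale, inv_mul_cancel₀ (lt_max_of_lt_left one_pos).ne']

theorem projPt_mem_sphere (x : Fin r → ℝ) :
    projPt x ∈ Metric.sphere (0 : (Fin r → ℝ) × ℝ) 1 := by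
  rw [mem_sphere_zero_iff_norm, norm_projPt]

theorem quad_inv_pos {θ : Param r} (hθ : (scatter θ).PosDef) {y : Fin r → ℝ} (hy : y ≠ 0) :
    0 < y ⬝ᵥ ((scatter θ)⁻¹.mulVec y) := by
  simpa using hθ.inv.dotProduct_mulVec_pos hy

theorem quad_inv_nonneg {θ : Param r} (hθ : (scatter θ).PosDef) (y : Fin r → ℝ) :
    0 ≤ y ⬝ᵥ ((scatter θ)⁻¹.mulVec y) := by
  simpa using hθ.inv.posSemidef.dotProduct_mulVec_nonneg y

theorem mahal_nonneg {θ : Param r} (hθ : (scatter θ).PosDef) (x : Fin r → ℝ) :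
    0 ≤ mahal θ x := quad_inv_nonneg hθ _

/-- Points at infinity (last coordinate zero) are included: there the first component is nonzero and
the inverse scatter matrix gives positivity. -/
theorem projQuad_pos (hν : 0 < ν) {θ : Param r} (hθ : (scatter θ).PosDef)
    {w : (Fin r → ℝ) × ℝ} (hw : w ≠ 0) : 0 < projQuad ν θ w := by
  unfold projQuad
  have h1 := quad_inv_nonneg hθ (w.1 - w.2 • loc θ)
  by_cases h : w.2 = 0
  · have h2 : w.1 - w.2 • loc θ ≠ 0 := by
      intro h3
      apply hw
      rw [h, zero_smul, sub_zero] at h3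
      exact Prod.ext h3 h
    have := quad_inv_pos hθ h2
    positivity
  · positivity

theorem projQuad_projPt (θ : Param r) (x : Fin r → ℝ) :
    projQuad ν θ (projPt x) = projScale x ^ 2 * (1 + mahal θ x / ν) := by
  simp only [projQuad, projPt, ← smul_sub, Matrix.mulVec_smul, dotProduct_smul, smul_dotProduct,
    smul_eq_mul, mahal]
  ring

theorem tConst_pos (hν : 0 < ν) : 0 < tConst r ν := by
  unfold tConst
  have h1 := Real.Gamma_pos_of_pos (half_pos hν)
  have h2 : 0 < Real.Gamma ((ν + r) / 2) := Real.Gamma_pos_of_pos (by positivity)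
  have := Real.pi_pos
  positivity

theorem one_add_mahal_pos (hν : 0 < ν) {θ : Param r} (hθ : (scatter θ).PosDef)
    (x : Fin r → ℝ) : 0 < 1 + mahal θ x / ν := by
  have := mahal_nonneg hθ x
  positivity

theorem tPdf_pos (hν : 0 < ν) {θ : Param r} (hθ : (scatter θ).PosDef) (x : Fin r → ℝ) :
    0 < tPdf ν θ x := by
  unfold tPdf
  have h1 := one_add_mahal_pos hν hθ x
  have h2 := hθ.det_pos
  have h3 := tConst_pos (r := r) hν
  positivity

theorem log_tPdf (hν : 0 < ν) {θ : Param r} (hθ : (scatter θ).PosDef) (x : Fin r → ℝ) :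
    Real.log (tPdf ν θ x) = Real.log (tConst r ν) - 1 / 2 * Real.log (scatter θ).det
      - (ν + r) / 2 * Real.log (1 + mahal θ x / ν) := by
  unfold tPdf
  have h1 := one_add_mahal_pos hν hθ x
  have h2 := hθ.det_pos
  have h3 := tConst_pos (r := r) hν
  rw [Real.log_mul (by positivity) (by positivity), Real.log_mul (by positivity) (by positivity),
    Real.log_rpow h1, Real.log_rpow h2]
  ring

/-- The form `projQuad` is homogeneous of degree two in w, so rescaling the point costs only a term
free of θ, invisible to derivatives and to comparisons of likelihoods. -/
theorem log_tPdf_eq_projLog (hν : 0 < ν) {θ : Param r} (hθ : (scatter θ).PosDef)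
    (x : Fin r → ℝ) :
    Real.log (tPdf ν θ x) = projLog ν θ (projPt x) + (ν + r) * Real.log (projScale x) := by
  have h1 := one_add_mahal_pos hν hθ x
  have h2 := projScale_pos x
  rw [log_tPdf hν hθ, projLog, projQuad_projPt, Real.log_mul (by positivity) h1.ne',
    Real.log_pow]
  push_cast
  ring

theorem contDiffAt_det {ι E : Type*} [Fintype ι] [DecidableEq ι] [NormedAddCommGroup E]
    [NormedSpace ℝ E] {n : WithTop ℕ∞} {M : E → Matrix ι ι ℝ} {p : E}
    (hM : ∀ i j, ContDiffAt ℝ n (fun q => M q i j) p) :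
    ContDiffAt ℝ n (fun q => (M q).det) p := by
  simp only [Matrix.det_apply']
  exact ContDiffAt.sum fun σ _ => contDiffAt_const.mul (contDiffAt_prod fun i _ => hM _ _)

/-- Cramer's rule: an entry of the adjugate is the determinant of the matrix with one row made
constant. -/
theorem contDiffAt_inv_entry {ι E : Type*} [Fintype ι] [DecidableEq ι] [NormedAddCommGroup E]
    [NormedSpace ℝ E] {n : WithTop ℕ∞} {M : E → Matrix ι ι ℝ} {p : E}
    (hM : ∀ i j, ContDiffAt ℝ n (fun q => M q i j) p) (hdet : (M p).det ≠ 0) (i j : ι) :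
    ContDiffAt ℝ n (fun q => (M q)⁻¹ i j) p := by
  simp only [Matrix.inv_def, Ring.inverse_eq_inv', Matrix.smul_apply, smul_eq_mul,
    Matrix.adjugate_apply]
  refine ((contDiffAt_det hM).inv hdet).mul (contDiffAt_det fun a b => ?_)
  by_cases h : a = j
  · subst h
    simp only [Matrix.updateRow_self]
    exact contDiffAt_const
  · simp only [Matrix.updateRow_ne h]
    exact hM a b

theorem contDiffAt_projLog {n : WithTop ℕ∞} (hν : 0 < ν) {θ : Param r}
    (hθ : (scatter θ).PosDef) {w : (Fin r → ℝ) × ℝ} (hw : w ≠ 0) :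
    ContDiffAt ℝ n (Function.uncurry (projLog (r := r) ν)) (θ, w) := by
  have hent : ∀ i j, ContDiffAt ℝ n
      (fun q : Param r × ((Fin r → ℝ) × ℝ) => scatter q.1 i j) (θ, w) := by
    intro i j
    simp only [scatter, Matrix.of_apply]
    fun_prop
  have hvec : ∀ i, ContDiffAt ℝ n
      (fun q : Param r × ((Fin r → ℝ) × ℝ) => (q.2.1 - q.2.2 • loc q.1) i) (θ, w) := by
    intro i
    simp only [loc, Pi.sub_apply, Pi.smul_apply, smul_eq_mul]
    fun_prop
  have hquad : ContDiffAt ℝ n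
      (fun q : Param r × ((Fin r → ℝ) × ℝ) => projQuad ν q.1 q.2) (θ, w) := by
    simp only [projQuad, dotProduct, Matrix.mulVec]
    refine ContDiffAt.add (by fun_prop) (ContDiffAt.div_const ?_ _)
    exact ContDiffAt.sum fun i _ => (hvec i).mul <| ContDiffAt.sum fun j _ =>
      (contDiffAt_inv_entry hent hθ.det_pos.ne' i j).mul (hvec j)
  change ContDiffAt ℝ n (fun q : Param r × ((Fin r → ℝ) × ℝ) => projLog ν q.1 q.2) (θ, w)
  simp only [projLog]
  exact (contDiffAt_const.sub (contDiffAt_const.mul ((contDiffAt_det hent).log hθ.det_pos.ne'))).sub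
    (contDiffAt_const.mul (hquad.log (projQuad_pos hν hθ hw).ne'))

end Density

/-! ### Logarithms of the likelihoods and the size of ε. -/

section Likelihood

variable {r N l : ℕ} {x : Fin N → Fin r → ℝ} {c : Fin N → Fin l} {m : Fin l} {ν : ℝ}

theorem sum_clusterSize (c : Fin N → Fin l) : ∑ m, (clusterSize c m : ℝ) = N := by
  have := Finset.card_eq_sum_card_fiberwise (f := c) (s := Finset.univ) (t := Finset.univ)
    (fun _ _ => Finset.mem_coe.2 (Finset.mem_univ _))
  simp only [Finset.card_univ, Fintype.card_fin] at this
  simp only [clusterSize, cluster]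
  exact_mod_cast this.symm

theorem clusterSize_le (c : Fin N → Fin l) (m : Fin l) : clusterSize c m ≤ N := by
  simpa [clusterSize] using Finset.card_le_univ (cluster c m)

theorem natCast_pos_of_clusterSize_pos (h : 0 < clusterSize c m) : (0 : ℝ) < N :=
  Nat.cast_pos.2 (h.trans_le (clusterSize_le c m))

theorem clusterLik_pos (hν : 0 < ν) (hc : 0 < clusterSize c m) {θ : Param r}
    (hθ : (scatter θ).PosDef) : 0 < clusterLik x c m ν θ := by
  have := natCast_pos_of_clusterSize_pos hc
  exact Finset.prod_pos fun n _ => mul_pos (by positivity) (tPdf_pos hν hθ _)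

theorem log_clusterLik (hν : 0 < ν) (hc : 0 < clusterSize c m) {θ : Param r}
    (hθ : (scatter θ).PosDef) :
    Real.log (clusterLik x c m ν θ) =
      clusterSize c m * (Real.log (clusterSize c m) - Real.log N)
        + ∑ n ∈ cluster c m, Real.log (tPdf ν θ (x n)) := by
  have hN := natCast_pos_of_clusterSize_pos hc
  have hc' : (0 : ℝ) < clusterSize c m := Nat.cast_pos.2 hc
  rw [clusterLik, Real.log_prod fun n _ => (mul_pos (by positivity) (tPdf_pos hν hθ _)).ne']
  rw [Finset.sum_congr rfl fun n _ => Real.log_mul (by positivity) (tPdf_pos hν hθ (x n)).ne',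
    Finset.sum_add_distrib, Finset.sum_const, nsmul_eq_mul, Real.log_div hc'.ne' hN.ne']
  rfl

/-- The part of the logarithm of the cluster likelihood that does not depend on the parameter. -/
def clusterOffset (x : Fin N → Fin r → ℝ) (c : Fin N → Fin l) (m : Fin l) (ν : ℝ) : ℝ :=
  clusterSize c m * (Real.log (clusterSize c m) - Real.log N)
    + ∑ n ∈ cluster c m, (ν + r) * Real.log (projScale (x n))

theorem log_clusterLik_eq_sum_projLog (hν : 0 < ν) (hc : 0 < clusterSize c m) {θ : Param r}
    (hθ : (scatter θ).PosDef) :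
    Real.log (clusterLik x c m ν θ) =
      clusterOffset x c m ν + ∑ n ∈ cluster c m, projLog ν θ (projPt (x n)) := by
  rw [log_clusterLik hν hc hθ, clusterOffset,
    Finset.sum_congr rfl fun n _ => log_tPdf_eq_projLog hν hθ (x n), Finset.sum_add_distrib]
  ring

theorem lik_pos {ν : Fin l → ℝ} (hν : ∀ m, 0 < ν m) (hc : ∀ m, 0 < clusterSize c m)
    {Θ : Fin l → Param r} (hΘ : ∀ m, (scatter (Θ m)).PosDef) : 0 < lik x c ν Θ :=
  Finset.prod_pos fun m _ => clusterLik_pos (hν m) (hc m) (hΘ m)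

theorem log_lik {ν : Fin l → ℝ} (hν : ∀ m, 0 < ν m) (hc : ∀ m, 0 < clusterSize c m)
    {Θ : Fin l → Param r} (hΘ : ∀ m, (scatter (Θ m)).PosDef) :
    Real.log (lik x c ν Θ) = ∑ m, Real.log (clusterLik x c m (ν m) (Θ m)) :=
  Real.log_prod fun m _ => (clusterLik_pos (hν m) (hc m) (hΘ m)).ne'

/-- The factors N_m / N contribute N_m log N_m - N_m log N, and the cluster sizes add up to N. -/
theorem log_lik_eq_dataFidelity_sub {ν : Fin l → ℝ} (hν : ∀ m, 0 < ν m)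
    (hc : ∀ m, 0 < clusterSize c m) {Θ : Fin l → Param r} (hΘ : ∀ m, (scatter (Θ m)).PosDef) :
    Real.log (lik x c ν Θ) = dataFidelity x c ν Θ - N * Real.log N := by
  rw [log_lik hν hc hΘ, ← sum_clusterSize c, dataFidelity, Finset.sum_mul, Finset.mul_sum,
    ← Finset.sum_sub_distrib, ← Finset.sum_add_distrib, ← Finset.sum_sub_distrib,
    ← Finset.sum_sub_distrib]
  refine Finset.sum_congr rfl fun m _ => ?_
  rw [log_clusterLik (hν m) (hc m) (hΘ m),
    Finset.sum_congr rfl fun n _ => log_tPdf (hν m) (hΘ m) (x n), Finset.sum_sub_distrib,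
    Finset.sum_const, nsmul_eq_mul, Finset.mul_sum, sum_clusterSize]
  have : ∀ n, 1 / 2 * ((ν m + r) * Real.log (1 + mahal (Θ m) (x n) / ν m)) =
    (ν m + r) / 2 * Real.log (1 + mahal (Θ m) (x n) / ν m) := fun n => by ring
  simp only [this]
  rw [← clusterSize]
  ring

/-- As δ ≥ 0, every weight lies between 0 and (ν + r)/ν, a ratio that is at least 1. -/
theorem eps_bounds (hν : 0 < ν) {θ : Param r} (hθ : (scatter θ).PosDef) :
    (clusterSize c m : ℝ) ≤ eps x c m ν θ ∧
      eps x c m ν θ ≤ ((ν + r) / ν) ^ 2 * clusterSize c m := by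
  refine ⟨le_max_right _ _, max_le ?_ ?_⟩
  · rw [mul_comm, clusterSize, ← nsmul_eq_mul]
    refine Finset.sum_le_card_nsmul _ _ _ fun n _ => ?_
    have := mahal_nonneg hθ (x n)
    rw [weight]
    gcongr
    linarith
  · have : 1 ≤ (ν + r) / ν := by rw [le_div_iff₀ hν]; simp
    exact le_mul_of_one_le_left (Nat.cast_nonneg _) (one_le_pow₀ this)

end Likelihood

/-! ### Simultaneous diagonalization by congruence. -/

section Diagonalization

open Matrix

variable {ι : Type*} [Fintype ι] [DecidableEq ι]

theorem posDef_mul_mul_transpose_iff {S M : Matrix ι ι ℝ} (hS : IsUnit S) :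
    (S * M * Sᵀ).PosDef ↔ M.PosDef := by
  have := Matrix.IsUnit.posDef_star_right_conjugate_iff (x := M) hS
  rwa [star_eq_conjTranspose, conjTranspose_eq_transpose_of_trivial] at this

/-- The spectral theorem, with the eigenvalues written as exponentials so that a path can later be
obtained by scaling the exponents. -/
theorem exists_orthogonal_diagonalization {A : Matrix ι ι ℝ} (hA : A.PosDef) :
    ∃ (U : Matrix ι ι ℝ) (a : ι → ℝ), U * Uᵀ = 1 ∧
      A = U * diagonal (fun k => Real.exp (a k)) * Uᵀ := by
  refine ⟨hA.1.eigenvectorUnitary, fun k => Real.log (hA.1.eigenvalues k), ?_, ?_⟩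
  · rw [← conjTranspose_eq_transpose_of_trivial]
    exact Unitary.mul_star_self_of_mem hA.1.eigenvectorUnitary.2
  · conv_lhs => rw [hA.1.spectral_theorem]
    rw [Unitary.conjStarAlgAut_apply, star_eq_conjTranspose,
      conjTranspose_eq_transpose_of_trivial]
    congr 3
    funext k
    simp [Real.exp_log (hA.eigenvalues_pos k)]

/-- Factor A₀ = S Sᵀ, diagonalize S⁻¹ A₁ S⁻ᵀ by an orthogonal V, and take B = S V; orthogonality of
V leaves the factorization of A₀ intact. -/
theorem exists_simultaneous_diagonalization {A₀ A₁ : Matrix ι ι ℝ} (h₀ : A₀.PosDef)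
    (h₁ : A₁.PosDef) :
    ∃ (B : Matrix ι ι ℝ) (a : ι → ℝ), IsUnit B ∧ A₀ = B * Bᵀ ∧
      A₁ = B * diagonal (fun k => Real.exp (a k)) * Bᵀ := by
  obtain ⟨U, b, hU, hA₀⟩ := exists_orthogonal_diagonalization h₀
  set d : Matrix ι ι ℝ := diagonal (fun k => Real.exp (b k / 2)) with hd
  set S := U * d with hS
  have hSu : IsUnit S := (IsUnit.of_mul_eq_one _ hU).mul <| by
    rw [isUnit_iff_isUnit_det, hd, det_diagonal]
    exact (Finset.prod_pos fun k _ => Real.exp_pos _).ne'.isUnit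
  have hdd : diagonal (fun k => Real.exp (b k)) = d * d := by
    rw [hd, diagonal_mul_diagonal]
    congr 1
    funext k
    rw [← Real.exp_add, add_halves]
  have hSS : A₀ = S * Sᵀ := by
    rw [hA₀, hS, transpose_mul, hdd, hd, diagonal_transpose]
    simp only [mul_assoc]
  have hSd : IsUnit S.det := (isUnit_iff_isUnit_det S).1 hSu
  have hSi : IsUnit S⁻¹ := by rwa [isUnit_nonsing_inv_iff]
  have hM : (S⁻¹ * A₁ * S⁻¹ᵀ).PosDef := (posDef_mul_mul_transpose_iff hSi).2 h₁
  obtain ⟨V, a, hV, hVa⟩ := exists_orthogonal_diagonalization hM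
  refine ⟨S * V, a, hSu.mul (IsUnit.of_mul_eq_one _ hV), ?_, ?_⟩
  · rw [transpose_mul, mul_assoc, ← mul_assoc V, hV, one_mul, hSS]
  · have h2 : S⁻¹ᵀ * Sᵀ = 1 := by rw [← transpose_mul, mul_nonsing_inv _ hSd, transpose_one]
    calc A₁ = (S * S⁻¹) * A₁ * (S⁻¹ᵀ * Sᵀ) := by
          rw [mul_nonsing_inv _ hSd, h2, one_mul, mul_one]
      _ = S * (S⁻¹ * A₁ * S⁻¹ᵀ) * Sᵀ := by simp only [mul_assoc]
      _ = _ := by rw [hVa, transpose_mul S V]; simp only [mul_assoc]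

theorem mul_diagonal_mul_transpose_apply (B : Matrix ι ι ℝ) (d : ι → ℝ) (i j : ι) :
    (B * diagonal d * Bᵀ) i j = ∑ k, B i k * d k * B j k := by
  rw [mul_apply]
  simp only [mul_diagonal, transpose_apply]

/-- The inverse is again a congruence of a diagonal matrix, with opposite exponents, so its
quadratic form is a nonnegative combination of exponentials. -/
theorem dotProduct_inv_mul_diagonal_mul_transpose {B : Matrix ι ι ℝ} (hB : IsUnit B) (a : ι → ℝ)
    (v : ι → ℝ) :
    v ⬝ᵥ ((B * diagonal (fun k => Real.exp (a k)) * Bᵀ)⁻¹ *ᵥ v) =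
      ∑ k, (B⁻¹ *ᵥ v) k ^ 2 * Real.exp (-a k) := by
  have hBd : IsUnit B.det := (isUnit_iff_isUnit_det B).1 hB
  have hinv : (B * diagonal (fun k => Real.exp (a k)) * Bᵀ)⁻¹ =
      B⁻¹ᵀ * diagonal (fun k => Real.exp (-a k)) * B⁻¹ := by
    refine inv_eq_right_inv ?_
    have h1 : Bᵀ * B⁻¹ᵀ = 1 := by rw [← transpose_mul, nonsing_inv_mul _ hBd, transpose_one]
    have h2 : (diagonal fun k => Real.exp (a k)) * (diagonal fun k => Real.exp (-a k)) =
        (1 : Matrix ι ι ℝ) := by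
      rw [diagonal_mul_diagonal, ← diagonal_one]
      congr 1
      funext k
      rw [← Real.exp_add, add_neg_cancel, Real.exp_zero]
    calc _ = B * ((diagonal fun k => Real.exp (a k)) * ((Bᵀ * B⁻¹ᵀ) *
          (diagonal fun k => Real.exp (-a k)))) * B⁻¹ := by simp only [mul_assoc]
      _ = 1 := by rw [h1, one_mul, h2, mul_one, mul_nonsing_inv _ hBd]
  rw [hinv, ← mulVec_mulVec, ← mulVec_mulVec, dotProduct_mulVec, vecMul_transpose]
  simp only [dotProduct, mulVec_diagonal]
  exact Finset.sum_congr rfl fun k _ => by ring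

end Diagonalization

/-! ### Location and scatter as one positive definite matrix, and geodesic convexity. -/

section Lift

open Matrix

variable {r : ℕ} {ν : ℝ}

/-- Homogeneous coordinates as a vector. -/
def homVec (w : (Fin r → ℝ) × ℝ) : Fin r ⊕ Unit → ℝ := Sum.elim w.1 fun _ => w.2

/-- The scatter matrix in one more dimension that encodes location and scatter. -/
def liftMat (ν : ℝ) (θ : Param r) : Matrix (Fin r ⊕ Unit) (Fin r ⊕ Unit) ℝ :=
  fromBlocks (ν • scatter θ + vecMulVec (loc θ) (loc θ)) (of fun i _ => loc θ i)
    (of fun _ j => loc θ j) 1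

/-- Location and scatter read off from a matrix in one more dimension, up to scale. -/
def unliftPar (ν : ℝ) (A : Matrix (Fin r ⊕ Unit) (Fin r ⊕ Unit) ℝ) : Param r :=
  Sum.elim (fun i => A (Sum.inl i) (Sum.inr ()) / A (Sum.inr ()) (Sum.inr ()))
    -- Averaging the two transposed entries lets the function descend to unordered pairs even when A
    -- is not symmetric.
    (Sym2.lift ⟨fun i j => ((A (Sum.inl i) (Sum.inl j) + A (Sum.inl j) (Sum.inl i)) / 2
        / A (Sum.inr ()) (Sum.inr ())
      - (A (Sum.inl i) (Sum.inr ()) / A (Sum.inr ()) (Sum.inr ()))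
        * (A (Sum.inl j) (Sum.inr ()) / A (Sum.inr ()) (Sum.inr ()))) / ν,
      fun i j => by ring⟩)

/-- The shear by a location vector. -/
def shear (μ : Fin r → ℝ) : Matrix (Fin r ⊕ Unit) (Fin r ⊕ Unit) ℝ :=
  fromBlocks 1 (of fun i _ => μ i) 0 1

theorem shear_mul_shear_neg (μ : Fin r → ℝ) : shear μ * shear (-μ) = 1 := by
  rw [shear, shear, fromBlocks_multiply, ← fromBlocks_one]
  congr 1 <;> ext i j <;> simp

theorem shear_neg_mul_shear (μ : Fin r → ℝ) : shear (-μ) * shear μ = 1 := by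
  simpa using shear_mul_shear_neg (-μ)

theorem isUnit_shear (μ : Fin r → ℝ) : IsUnit (shear μ) :=
  IsUnit.of_mul_eq_one _ (shear_mul_shear_neg μ)

theorem det_shear (μ : Fin r → ℝ) : (shear μ).det = 1 := by
  simp [shear]

/-- The scatter matrix with an additional unit variance. -/
def scatterOne (ν : ℝ) (θ : Param r) : Matrix (Fin r ⊕ Unit) (Fin r ⊕ Unit) ℝ :=
  fromBlocks (ν • scatter θ) 0 0 1

/-- A congruence by a unipotent matrix removes the location, reducing definiteness, determinant and
inverse of the lift to those of the scatter matrix. -/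
theorem liftMat_eq (ν : ℝ) (θ : Param r) :
    liftMat ν θ = shear (loc θ) * scatterOne ν θ * (shear (loc θ))ᵀ := by
  rw [liftMat, shear, scatterOne, fromBlocks_transpose, fromBlocks_multiply, fromBlocks_multiply]
  congr 1
  · ext i j; simp [vecMulVec_apply, Matrix.mul_apply]
  · ext i j; simp
  · ext i j; simp
  · ext i j; simp

theorem posDef_scatterOne_iff (hν : 0 < ν) {θ : Param r} :
    (scatterOne ν θ).PosDef ↔ (scatter θ).PosDef := by
  constructor
  · intro h
    have h1 : (ν • scatter θ).PosDef := h.submatrix (e := Sum.inl) Sum.inl_injective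
    have h2 := h1.smul (inv_pos.2 hν)
    rwa [smul_smul, inv_mul_cancel₀ hν.ne', one_smul] at h2
  · intro h
    have h1 : (ν • scatter θ).PosDef := h.smul hν
    refine Matrix.PosDef.of_dotProduct_mulVec_pos ?_ fun {v} hv => ?_
    · exact Matrix.IsHermitian.fromBlocks h1.1 (by simp) Matrix.isHermitian_one
    · have h2 : star v ⬝ᵥ scatterOne ν θ *ᵥ v =
          (v ∘ Sum.inl) ⬝ᵥ (ν • scatter θ) *ᵥ (v ∘ Sum.inl) + v (Sum.inr ()) ^ 2 := by
        conv_lhs => rw [← Sum.elim_comp_inl_inr v]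
        rw [scatterOne, fromBlocks_mulVec]
        simp [dotProduct, Fintype.sum_sum_type, sq]
      rw [h2]
      have h3 := h1.posSemidef.dotProduct_mulVec_nonneg (v ∘ Sum.inl)
      rw [star_trivial] at h3
      by_cases h4 : v (Sum.inr ()) = 0
      · have h5 : v ∘ Sum.inl ≠ 0 := by
          intro h6
          apply hv
          funext k
          rcases k with i | u
          · exact congrFun h6 i
          · exact h4
        have h6 := h1.dotProduct_mulVec_pos h5
        rw [star_trivial] at h6
        positivity
      · positivity

theorem posDef_liftMat_iff (hν : 0 < ν) {θ : Param r} :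
    (liftMat ν θ).PosDef ↔ (scatter θ).PosDef := by
  rw [liftMat_eq, posDef_mul_mul_transpose_iff (isUnit_shear _), posDef_scatterOne_iff hν]

theorem det_liftMat (ν : ℝ) (θ : Param r) :
    (liftMat ν θ).det = ν ^ r * (scatter θ).det := by
  rw [liftMat_eq, det_mul, det_mul, det_transpose, det_shear, scatterOne,
    det_fromBlocks_zero₂₁, det_smul]
  simp

/-- The inverse shear sends (y, s) to (y - s μ, s), on which the inverse of the block diagonal
matrix is evaluated. -/
theorem dotProduct_inv_liftMat (hν : 0 < ν) {θ : Param r} (hθ : (scatter θ).PosDef)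
    (w : (Fin r → ℝ) × ℝ) :
    homVec w ⬝ᵥ ((liftMat ν θ)⁻¹ *ᵥ homVec w) = projQuad ν θ w := by
  have hdet : IsUnit (scatter θ).det := hθ.det_pos.ne'.isUnit
  set T := shear (-loc θ) with hT
  have hinv : (liftMat ν θ)⁻¹ = Tᵀ * fromBlocks (ν⁻¹ • (scatter θ)⁻¹) 0 0 1 * T := by
    refine inv_eq_right_inv ?_
    rw [liftMat_eq]
    have h1 : (shear (loc θ))ᵀ * Tᵀ = 1 := by
      rw [← transpose_mul, shear_neg_mul_shear, transpose_one]
    have h2 : scatterOne ν θ * fromBlocks (ν⁻¹ • (scatter θ)⁻¹) 0 0 1 = 1 := by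
      rw [scatterOne, fromBlocks_multiply, ← fromBlocks_one]
      congr 1
      · simp [smul_smul, mul_nonsing_inv _ hdet, hν.ne']
      · simp
      · simp
      · simp
    calc _ = shear (loc θ) * (scatterOne ν θ * (((shear (loc θ))ᵀ * Tᵀ) *
          fromBlocks (ν⁻¹ • (scatter θ)⁻¹) 0 0 1)) * T := by simp only [mul_assoc]
      _ = 1 := by rw [h1, one_mul, h2, mul_one, shear_mul_shear_neg]
  have hTv : T *ᵥ homVec w = Sum.elim (w.1 - w.2 • loc θ) fun _ => w.2 := by
    rw [hT, shear, homVec, fromBlocks_mulVec]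
    congr 1
    · funext i
      simp [mulVec, dotProduct, sub_eq_add_neg, mul_comm]
    · funext i
      simp
  rw [hinv, ← mulVec_mulVec, ← mulVec_mulVec, dotProduct_mulVec, vecMul_transpose, hTv,
    fromBlocks_mulVec, projQuad]
  simp only [dotProduct, Fintype.sum_sum_type]
  simp [smul_mulVec, Finset.sum_div, sq, add_comm]
  exact Finset.sum_congr rfl fun i _ => by ring

theorem unliftPar_liftMat (hν : 0 < ν) (θ : Param r) : unliftPar ν (liftMat ν θ) = θ := by
  funext k
  rcases k with i | s
  · simp [unliftPar, liftMat, loc]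
  · induction s with
    | _ i j =>
      have : θ (Sum.inr s(j, i)) = θ (Sum.inr s(i, j)) := by rw [Sym2.eq_swap]
      simp [unliftPar, liftMat, scatter, vecMulVec_apply, this]
      field_simp
      ring

theorem smul_liftMat_unliftPar (hν : 0 < ν) {A : Matrix (Fin r ⊕ Unit) (Fin r ⊕ Unit) ℝ}
    (hA : Aᵀ = A) (ha : A (Sum.inr ()) (Sum.inr ()) ≠ 0) :
    A (Sum.inr ()) (Sum.inr ()) • liftMat ν (unliftPar ν A) = A := by
  have hsymm : ∀ i j, A i j = A j i := fun i j => congrFun (congrFun hA j) i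
  ext i j
  rcases i with i | u <;> rcases j with j | v
  · simp [unliftPar, liftMat, scatter, vecMulVec_apply, loc, hsymm (Sum.inl j) (Sum.inl i)]
    field_simp
    ring
  · simp [unliftPar, liftMat, loc]
    field_simp
  · simp [unliftPar, liftMat, loc, hsymm (Sum.inr u) (Sum.inl j)]
    field_simp
  · simp [liftMat]

theorem posDef_scatter_unliftPar (hν : 0 < ν) {A : Matrix (Fin r ⊕ Unit) (Fin r ⊕ Unit) ℝ}
    (hA : A.PosDef) : (scatter (unliftPar ν A)).PosDef := by
  have ha : 0 < A (Sum.inr ()) (Sum.inr ()) := hA.diag_pos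
  have hAt : Aᵀ = A := by
    have := hA.1
    rwa [IsHermitian, conjTranspose_eq_transpose_of_trivial] at this
  rw [← posDef_liftMat_iff hν]
  have h2 := hA.smul (inv_pos.2 ha)
  rw [← smul_liftMat_unliftPar hν hAt ha.ne'] at h2
  rwa [smul_smul, smul_liftMat_unliftPar hν hAt ha.ne', inv_mul_cancel₀ ha.ne', one_smul] at h2

/-- Dividing A by its last diagonal entry a turns it into a lift. The determinant contributes (r +
1)/2 and the quadratic form -(ν + r)/2 to the coefficient of log a, leaving -(ν - 1)/2. The sign of
this coefficient is what separates ν ≥ 1 from ν < 1. -/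
theorem projLog_unliftPar (hν : 0 < ν) {A : Matrix (Fin r ⊕ Unit) (Fin r ⊕ Unit) ℝ}
    (hA : A.PosDef) {w : (Fin r → ℝ) × ℝ} (hw : w ≠ 0) :
    projLog ν (unliftPar ν A) w = Real.log (tConst r ν) + r / 2 * Real.log ν
      - 1 / 2 * Real.log A.det
      - (ν - 1) / 2 * Real.log (A (Sum.inr ()) (Sum.inr ()))
      - (ν + r) / 2 * Real.log (homVec w ⬝ᵥ (A⁻¹ *ᵥ homVec w)) := by
  have ha : 0 < A (Sum.inr ()) (Sum.inr ()) := hA.diag_pos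
  have hAt : Aᵀ = A := by
    have := hA.1
    rwa [IsHermitian, conjTranspose_eq_transpose_of_trivial] at this
  set a := A (Sum.inr ()) (Sum.inr ()) with ha'
  set θ := unliftPar ν A with hθ'
  have hθ : (scatter θ).PosDef := posDef_scatter_unliftPar hν hA
  have hAeq : A = a • liftMat ν θ := (smul_liftMat_unliftPar hν hAt ha.ne').symm
  have hq := projQuad_pos hν hθ hw
  have hd := hθ.det_pos
  have hdet : A.det = a ^ (r + 1) * (ν ^ r * (scatter θ).det) := by
    conv_lhs => rw [hAeq]
    rw [det_smul, det_liftMat]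
    simp
  have hdetl : IsUnit (liftMat ν θ).det := by
    rw [det_liftMat]
    exact (by positivity : (0 : ℝ) < ν ^ r * (scatter θ).det).ne'.isUnit
  have hquad : homVec w ⬝ᵥ (A⁻¹ *ᵥ homVec w) = a⁻¹ * projQuad ν θ w := by
    have hinv : A⁻¹ = a⁻¹ • (liftMat ν θ)⁻¹ := by
      refine inv_eq_right_inv ?_
      rw [hAeq, smul_mul_smul_comm, mul_nonsing_inv _ hdetl, mul_inv_cancel₀ ha.ne', one_smul]
    rw [hinv, smul_mulVec, dotProduct_smul, dotProduct_inv_liftMat hν hθ, smul_eq_mul]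
  rw [hquad, hdet, projLog, Real.log_mul (by positivity) (by positivity),
    Real.log_mul (by positivity) (by positivity), Real.log_mul (by positivity) (by positivity),
    Real.log_pow, Real.log_pow, Real.log_inv]
  push_cast
  ring

theorem differentiable_unliftPar_comp {A : ℝ → Matrix (Fin r ⊕ Unit) (Fin r ⊕ Unit) ℝ}
    (hA : ∀ i j, Differentiable ℝ fun t => A t i j)
    (ha : ∀ t, A t (Sum.inr ()) (Sum.inr ()) ≠ 0) :
    Differentiable ℝ fun t => unliftPar ν (A t) := by
  rw [differentiable_pi]
  intro k
  rcases k with i | s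
  · simp only [unliftPar, Sum.elim_inl]
    exact (hA _ _).div (hA _ _) ha
  · induction s with
    | _ i j =>
      simp only [unliftPar, Sum.elim_inr, Sym2.lift_mk]
      exact (((((hA _ _).add (hA _ _)).div_const 2).div (hA _ _) ha).sub
        (((hA _ _).div (hA _ _) ha).mul ((hA _ _).div (hA _ _) ha))).div_const ν

/-- Any two cluster parameters are joined by a smooth path along which the negative log-density
is convex, for every data vector, as soon as there is at least one degree of freedom. -/
theorem exists_path_convexOn_neg_projLog (hν : 1 ≤ ν) {θ₀ θ₁ : Param r}
    (h₀ : (scatter θ₀).PosDef) (h₁ : (scatter θ₁).PosDef) :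
    ∃ γ : ℝ → Param r, γ 0 = θ₀ ∧ γ 1 = θ₁ ∧ Differentiable ℝ γ ∧
      (∀ t, (scatter (γ t)).PosDef) ∧
      ∀ w : (Fin r → ℝ) × ℝ, w ≠ 0 →
        ConvexOn ℝ Set.univ fun t => -projLog ν (γ t) w := by
  have hν0 : 0 < ν := by linarith
  obtain ⟨B, a, hB, hB₀, hB₁⟩ := exists_simultaneous_diagonalization
    ((posDef_liftMat_iff hν0).2 h₀) ((posDef_liftMat_iff hν0).2 h₁)
  -- The geodesic between the two lifts in the cone of positive definite matrices. Its last diagonal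
  -- entry need not stay 1, so `unliftPar` has to renormalize.
  set A : ℝ → Matrix (Fin r ⊕ Unit) (Fin r ⊕ Unit) ℝ := fun t =>
    B * diagonal (fun k => Real.exp (t * a k)) * Bᵀ with hA
  have hApd : ∀ t, (A t).PosDef := fun t =>
    (posDef_mul_mul_transpose_iff hB).2 (Matrix.PosDef.diagonal fun k => Real.exp_pos _)
  have hAent : ∀ t i j, A t i j = ∑ k, B i k * Real.exp (t * a k) * B j k := fun t i j =>
    mul_diagonal_mul_transpose_apply B _ i j
  have hdiag : ∀ t, 0 < A t (Sum.inr ()) (Sum.inr ()) := fun t => (hApd t).diag_pos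
  have hBd : IsUnit B.det := (isUnit_iff_isUnit_det B).1 hB
  refine ⟨fun t => unliftPar ν (A t), ?_, ?_, ?_, fun t => posDef_scatter_unliftPar hν0 (hApd t),
    fun w hw => ?_⟩
  · have : A 0 = liftMat ν θ₀ := by simp [hA, hB₀]
    simp only [this, unliftPar_liftMat hν0]
  · have : A 1 = liftMat ν θ₁ := by simp [hA, hB₁]
    simp only [this, unliftPar_liftMat hν0]
  · refine differentiable_unliftPar_comp (fun i j => ?_) fun t => (hdiag t).ne'
    simp only [hAent]
    fun_prop
  · have hlast : ConvexOn ℝ Set.univ fun t => Real.log (A t (Sum.inr ()) (Sum.inr ())) := by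
      have h := convexOn_log_sum_exp Finset.univ (fun k => B (Sum.inr ()) k ^ 2) a
        (fun k _ => sq_nonneg _) (by
          -- If the last row of B vanished, the last diagonal entry of A 0 would not be positive.
          by_contra! hcon
          have h0 := hdiag 0
          rw [hAent] at h0
          refine absurd h0 (not_lt.2 (Finset.sum_nonpos fun k _ => ?_))
          have := hcon k (Finset.mem_univ _)
          have h2 : B (Sum.inr ()) k = 0 := by nlinarith
          simp [h2])
      refine h.congr fun t _ => ?_
      simp only [hAent]
      congr 1
      exact Finset.sum_congr rfl fun k _ => by ring
    have hquad : ConvexOn ℝ Set.univ fun t =>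
        Real.log (homVec w ⬝ᵥ ((A t)⁻¹ *ᵥ homVec w)) := by
      have hne : B⁻¹ *ᵥ homVec w ≠ 0 := by
        intro h
        apply hw
        have h1 : homVec w = 0 := by
          rw [← one_mulVec (homVec w), ← mul_nonsing_inv _ hBd, ← mulVec_mulVec, h, mulVec_zero]
        refine Prod.ext (funext fun i => congrFun h1 (Sum.inl i)) (congrFun h1 (Sum.inr ()))
      obtain ⟨k, hk⟩ := Function.ne_iff.1 hne
      have h := convexOn_log_sum_exp Finset.univ (fun k => (B⁻¹ *ᵥ homVec w) k ^ 2) (fun k => -a k)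
        (fun k _ => sq_nonneg _) ⟨k, Finset.mem_univ _, by
          have : (B⁻¹ *ᵥ homVec w) k ≠ 0 := hk
          positivity⟩
      refine h.congr fun t _ => ?_
      simp only [hA, dotProduct_inv_mul_diagonal_mul_transpose hB, mul_neg]
    have hdet : ConvexOn ℝ Set.univ fun t => Real.log (A t).det := by
      have h1 : (fun t => Real.log (A t).det) = fun t =>
          Real.log (B.det ^ 2) + t * ∑ k, a k := by
        funext t
        have h2 : 0 < B.det ^ 2 := by
          have := hBd.ne_zero
          positivity
        rw [hA]
        simp only [det_mul, det_transpose, det_diagonal]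
        rw [← Real.exp_sum, ← Finset.mul_sum,
          show B.det * Real.exp (t * ∑ k, a k) * B.det = B.det ^ 2 * Real.exp (t * ∑ k, a k) by ring,
          Real.log_mul h2.ne' (Real.exp_pos _).ne', Real.log_exp]
      rw [h1]
      refine ⟨convex_univ, fun x _ y _ p q _ _ hpq => le_of_eq ?_⟩
      simp only [smul_eq_mul]
      linear_combination (-Real.log (B.det ^ 2)) * hpq
    -- The log-determinant is affine in t; ν ≥ 1 is used for the coefficient (ν - 1)/2 of the last
    -- diagonal entry.
    have h := ((hdet.smul (by norm_num : (0 : ℝ) ≤ 1 / 2)).add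
      (hlast.smul (by linarith : (0 : ℝ) ≤ (ν - 1) / 2))).add
      (hquad.smul (by positivity : (0 : ℝ) ≤ (ν + r) / 2)) |>.add_const
        (-(Real.log (tConst r ν) + r / 2 * Real.log ν))
    refine h.congr fun t _ => ?_
    simp only [projLog_unliftPar hν0 (hApd t) hw, Pi.add_apply, smul_eq_mul]
    ring

end Lift

/-! ### Local and global bounds for sums of log-densities. -/

section SumProjLog

variable {r : ℕ} {ν : ℝ} {ι : Type*}

/-- Parameters carry the sup norm, while the Fisher information bound is Euclidean. -/
theorem sq_norm_le_sum_sq {κ : Type*} [Fintype κ] (v : κ → ℝ) : ‖v‖ ^ 2 ≤ ∑ a, v a ^ 2 := by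
  have h0 : 0 ≤ ∑ a, v a ^ 2 := Finset.sum_nonneg fun _ _ => sq_nonneg _
  rw [← Real.le_sqrt (norm_nonneg _) h0, pi_norm_le_iff_of_nonneg (Real.sqrt_nonneg _)]
  intro a
  rw [Real.le_sqrt (norm_nonneg _) h0, Real.norm_eq_abs, sq_abs]
  exact Finset.single_le_sum (f := fun a => v a ^ 2) (fun _ _ => sq_nonneg _) (Finset.mem_univ a)

/-- The logarithm of a product of `t` densities in homogeneous coordinates. -/
def sumProjLog (ν : ℝ) (s : Finset ι) (w : ι → (Fin r → ℝ) × ℝ) (θ : Param r) : ℝ :=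
  ∑ n ∈ s, projLog ν θ (w n)

variable {s : Finset ι} {w : ι → (Fin r → ℝ) × ℝ}

theorem ne_zero_of_mem_unit_sphere {E : Type*} [NormedAddCommGroup E] {w : E}
    (hw : w ∈ Metric.sphere (0 : E) 1) : w ≠ 0 := by
  rintro rfl
  simp at hw

theorem hasFDerivAt_sumProjLog (hν : 0 < ν) (hw : ∀ n ∈ s, w n ≠ 0) {θ : Param r}
    (hθ : (scatter θ).PosDef) :
    HasFDerivAt (sumProjLog ν s w)
      (∑ n ∈ s, fderiv ℝ (fun η => projLog ν η (w n)) θ) θ :=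
  HasFDerivAt.fun_sum fun n hn => hasFDerivAt_partial (contDiffAt_projLog hν hθ (hw n hn))

theorem hasFDerivAt_fderiv_sumProjLog (hν : 0 < ν) (hw : ∀ n ∈ s, w n ≠ 0) {θ : Param r}
    (hθ : ∀ᶠ η in 𝓝 θ, (scatter η).PosDef) :
    HasFDerivAt (fun η => fderiv ℝ (sumProjLog ν s w) η)
      (∑ n ∈ s, fderiv ℝ (fun η => fderiv ℝ (fun ζ => projLog ν ζ (w n)) η) θ) θ := by
  have h : HasFDerivAt (fun η => ∑ n ∈ s, fderiv ℝ (fun ζ => projLog ν ζ (w n)) η)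
      (∑ n ∈ s, fderiv ℝ (fun η => fderiv ℝ (fun ζ => projLog ν ζ (w n)) η) θ) θ :=
    HasFDerivAt.fun_sum fun n hn =>
      hasFDerivAt_partial_fderiv (contDiffAt_projLog hν hθ.self_of_nhds (hw n hn))
  refine h.congr_of_eventuallyEq ?_
  filter_upwards [hθ] with η hη
  exact (hasFDerivAt_sumProjLog hν hw hη).fderiv

theorem eventually_posDef_of_closedBall_subset {K' : Set (Param r)} {ρ₀ : ℝ} (hρ₀ : 0 < ρ₀)
    (hpd : ∀ θ ∈ K', (scatter θ).PosDef) {θ : Param r} (hθ : Metric.closedBall θ ρ₀ ⊆ K') :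
    ∀ᶠ η in 𝓝 θ, (scatter η).PosDef := by
  filter_upwards [Metric.closedBall_mem_nhds θ hρ₀] with η hη
  exact hpd η (hθ hη)

variable {K K' : Set (Param r)} {ρ₀ : ℝ}

/-- The errors of the summands add up. What matters is the order of quantifiers: ρ is fixed before
the number of points and the points themselves, since these range over a compact sphere. -/
theorem exists_uniform_taylor_sumProjLog (hν : 0 < ν) (hρ₀ : 0 < ρ₀) (hK' : IsCompact K')
    (hKK' : ∀ θ ∈ K, Metric.closedBall θ ρ₀ ⊆ K') (hpd : ∀ θ ∈ K', (scatter θ).PosDef)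
    {ε : ℝ} (hε : 0 < ε) :
    ∃ ρ, 0 < ρ ∧ ρ ≤ ρ₀ ∧ ∀ (ι : Type) (s : Finset ι) (w : ι → (Fin r → ℝ) × ℝ),
      (∀ n ∈ s, w n ∈ Metric.sphere (0 : (Fin r → ℝ) × ℝ) 1) → ∀ θ ∈ K, ∀ h, ‖h‖ ≤ ρ →
      |sumProjLog ν s w (θ + h) - sumProjLog ν s w θ - fderiv ℝ (sumProjLog ν s w) θ h
        - 1 / 2 * fderiv ℝ (fun η => fderiv ℝ (sumProjLog ν s w) η) θ h h|
        ≤ ε * s.card * ‖h‖ ^ 2 := by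
  obtain ⟨ρ, hρ, hρ', H⟩ := exists_uniform_taylor (K := K) (L := projLog (r := r) ν) hρ₀ hε hK'
    (isCompact_sphere (0 : (Fin r → ℝ) × ℝ) 1) hKK'
    (fun θ hθ w hw => contDiffAt_projLog hν (hpd θ hθ) (ne_zero_of_mem_unit_sphere hw))
  refine ⟨ρ, hρ, hρ', fun ι s w hw θ hθ h hh => ?_⟩
  have hev := eventually_posDef_of_closedBall_subset hρ₀ hpd (hKK' θ hθ)
  have hw0 : ∀ n ∈ s, w n ≠ 0 := fun n hn => ne_zero_of_mem_unit_sphere (hw n hn)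
  rw [(hasFDerivAt_sumProjLog hν hw0 hev.self_of_nhds).fderiv,
    (hasFDerivAt_fderiv_sumProjLog hν hw0 hev).fderiv]
  simp only [sumProjLog, sum_apply]
  rw [Finset.mul_sum, ← Finset.sum_sub_distrib, ← Finset.sum_sub_distrib,
    ← Finset.sum_sub_distrib]
  refine (Finset.abs_sum_le_sum_abs _ _).trans ?_
  refine (Finset.sum_le_card_nsmul _ _ _ fun n hn => H θ hθ (w n) (hw n hn) h hh).trans ?_
  rw [nsmul_eq_mul]
  exact le_of_eq (by ring)

/-- Quadratic upper bound near a nondegenerate critical point. -/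
theorem exists_sumProjLog_le (hν : 0 < ν) (hρ₀ : 0 < ρ₀) (hK' : IsCompact K')
    (hKK' : ∀ θ ∈ K, Metric.closedBall θ ρ₀ ⊆ K') (hpd : ∀ θ ∈ K', (scatter θ).PosDef)
    {κ : ℝ} (hκ : 0 < κ) :
    ∃ ρ, 0 < ρ ∧ ρ ≤ ρ₀ ∧ ∀ (ι : Type) (s : Finset ι) (w : ι → (Fin r → ℝ) × ℝ),
      (∀ n ∈ s, w n ∈ Metric.sphere (0 : (Fin r → ℝ) × ℝ) 1) → ∀ θ ∈ K,
      fderiv ℝ (sumProjLog ν s w) θ = 0 →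
      (∀ h, fderiv ℝ (fun η => fderiv ℝ (sumProjLog ν s w) η) θ h h
        ≤ -κ * s.card * ∑ a, h a ^ 2) →
      ∀ h, ‖h‖ ≤ ρ →
        sumProjLog ν s w (θ + h) ≤ sumProjLog ν s w θ - κ / 4 * s.card * ∑ a, h a ^ 2 := by
  obtain ⟨ρ, hρ, hρ', H⟩ := exists_uniform_taylor_sumProjLog hν hρ₀ hK' hKK' hpd
    -- Half of the Hessian bound is -κ/2; a Taylor error of κ/4 leaves -κ/4.
    (show 0 < κ / 4 by positivity)
  refine ⟨ρ, hρ, hρ', fun ι s w hw θ hθ h0 h2 h hh => ?_⟩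
  have h3 := (abs_le.1 (H ι s w hw θ hθ h hh)).2
  have h4 := h2 h
  have h5 : κ / 4 * s.card * ‖h‖ ^ 2 ≤ κ / 4 * s.card * ∑ a, h a ^ 2 := by
    gcongr
    exact sq_norm_le_sum_sq h
  rw [h0] at h3
  simp only [zero_apply] at h3
  linarith

/-- Quadratic lower bound near a critical point. -/
theorem exists_le_sumProjLog (hν : 0 < ν) (hρ₀ : 0 < ρ₀) (hK' : IsCompact K')
    (hKK' : ∀ θ ∈ K, Metric.closedBall θ ρ₀ ⊆ K') (hpd : ∀ θ ∈ K', (scatter θ).PosDef) :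
    ∃ ρ, 0 < ρ ∧ ∃ C, 0 < C ∧ ∀ (ι : Type) (s : Finset ι) (w : ι → (Fin r → ℝ) × ℝ),
      (∀ n ∈ s, w n ∈ Metric.sphere (0 : (Fin r → ℝ) × ℝ) 1) → ∀ θ ∈ K,
      fderiv ℝ (sumProjLog ν s w) θ = 0 → ∀ h, ‖h‖ ≤ ρ →
        sumProjLog ν s w θ - C * s.card * ‖h‖ ^ 2 ≤ sumProjLog ν s w (θ + h) := by
  obtain ⟨ρ, hρ, hρ', H⟩ := exists_uniform_taylor_sumProjLog hν hρ₀ hK' hKK' hpd one_pos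
  obtain ⟨C, hC, hC'⟩ := exists_bound_partial_hessian (L := projLog (r := r) ν) hK'
    (isCompact_sphere (0 : (Fin r → ℝ) × ℝ) 1)
    (fun θ hθ w hw => contDiffAt_projLog hν (hpd θ hθ) (ne_zero_of_mem_unit_sphere hw))
  -- The 1 is the Taylor error, and C generously covers half of the Hessian bound.
  refine ⟨ρ, hρ, 1 + C, by positivity, fun ι s w hw θ hθ h0 h hh => ?_⟩
  have h3 := (abs_le.1 (H ι s w hw θ hθ h hh)).1
  have hev := eventually_posDef_of_closedBall_subset hρ₀ hpd (hKK' θ hθ)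
  have hθ' : θ ∈ K' := hKK' θ hθ (Metric.mem_closedBall_self hρ₀.le)
  have hw0 : ∀ n ∈ s, w n ≠ 0 := fun n hn => ne_zero_of_mem_unit_sphere (hw n hn)
  have h4 : |fderiv ℝ (fun η => fderiv ℝ (sumProjLog ν s w) η) θ h h|
      ≤ s.card * (C * ‖h‖ ^ 2) := by
    rw [(hasFDerivAt_fderiv_sumProjLog hν hw0 hev).fderiv]
    simp only [sum_apply]
    refine (Finset.abs_sum_le_sum_abs _ _).trans ?_
    rw [← nsmul_eq_mul]
    refine Finset.sum_le_card_nsmul _ _ _ fun n hn => ?_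
    rw [← Real.norm_eq_abs]
    refine (ContinuousLinearMap.le_opNorm₂ _ _ _).trans ?_
    rw [mul_assoc, ← sq]
    gcongr
    exact hC' θ hθ' (w n) (hw n hn)
  have h5 := (abs_le.1 h4).1
  rw [h0] at h3
  simp only [zero_apply] at h3
  nlinarith [sq_nonneg ‖h‖, mul_nonneg (mul_nonneg hC.le (Nat.cast_nonneg (α := ℝ) s.card))
    (sq_nonneg ‖h‖)]

/-- With at least one degree of freedom a local bound at distance `ρ` of a critical point
propagates to all parameters at larger distance. -/
theorem sumProjLog_le_of_le_dist (hν : 1 ≤ ν) (hw : ∀ n ∈ s, w n ≠ 0) {θ θ₁ : Param r}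
    (hθ : (scatter θ).PosDef) (hθ₁ : (scatter θ₁).PosDef)
    (h0 : fderiv ℝ (sumProjLog ν s w) θ = 0) {ρ b : ℝ} (hρ : 0 ≤ ρ)
    (hb : ∀ h, ‖h‖ = ρ → sumProjLog ν s w (θ + h) ≤ b) (hd : ρ ≤ dist θ₁ θ) :
    sumProjLog ν s w θ₁ ≤ b := by
  obtain ⟨γ, h1, h2, h3, h4, h5⟩ := exists_path_convexOn_neg_projLog hν hθ hθ₁
  have hcont : ContinuousOn (fun t => dist (γ t) θ) (Set.Icc 0 1) :=
    (h3.continuous.dist continuous_const).continuousOn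
  -- The path to θ₁ crosses the sphere of radius ρ around θ; convexity and the zero derivative at
  -- the start make the value at the end no larger than at the crossing.
  obtain ⟨t, ht, hteq⟩ := intermediate_value_Icc zero_le_one hcont
    (show ρ ∈ Set.Icc (dist (γ 0) θ) (dist (γ 1) θ) by simp [h1, h2, hρ, hd])
  have hconv : ConvexOn ℝ Set.univ fun t => -sumProjLog ν s w (γ t) := by
    simp only [sumProjLog, ← Finset.sum_neg_distrib]
    refine Finset.sum_induction (fun n t => -projLog ν (γ t) (w n))
      (fun f => ConvexOn ℝ Set.univ f) (fun f g hf hg => hf.add hg)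
      (convexOn_const 0 convex_univ) (fun n hn => h5 _ (hw n hn)) |>.congr fun t _ => ?_
    simp
  have hder : HasDerivAt (fun t => -sumProjLog ν s w (γ t)) 0 0 := by
    have h6 := hasFDerivAt_sumProjLog (one_pos.trans_le hν) hw hθ
    rw [h6.fderiv] at h0
    rw [h0, ← h1] at h6
    refine (h6.comp_hasDerivAt 0 (h3 0).hasDerivAt).neg.congr_deriv ?_
    simp
  have h7 := le_of_convexOn_of_hasDerivAt_zero hconv hder ht.1 ht.2
  have h8 := hb (γ t - θ) (by rw [← dist_eq_norm]; exact hteq)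
  rw [add_sub_cancel] at h8
  simp only [h2] at h7
  linarith

end SumProjLog

/-! ### From the Fisher information matrix to the Hessian. -/

section Fisher

variable {r N l : ℕ} {x : Fin N → Fin r → ℝ} {c : Fin N → Fin l} {m : Fin l} {ν : ℝ}

/-- The logarithm of the cluster likelihood in homogeneous coordinates, without the part that does
not depend on the parameter. -/
def clusterProjLog (x : Fin N → Fin r → ℝ) (c : Fin N → Fin l) (m : Fin l) (ν : ℝ)
    (θ : Param r) : ℝ :=
  sumProjLog ν (cluster c m) (fun n => projPt (x n)) θ

theorem log_clusterLik_eq (hν : 0 < ν) (hc : 0 < clusterSize c m) {θ : Param r}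
    (hθ : (scatter θ).PosDef) :
    Real.log (clusterLik x c m ν θ) = clusterOffset x c m ν + clusterProjLog x c m ν θ :=
  log_clusterLik_eq_sum_projLog hν hc hθ

theorem fisher_eq (hν : 0 < ν) (hc : 0 < clusterSize c m) {θ : Param r}
    (hθ : ∀ᶠ η in 𝓝 θ, (scatter η).PosDef) (a b : ParamIx r) :
    fisher x c m ν θ a b = -(fderiv ℝ (fun η => fderiv ℝ (clusterProjLog x c m ν) η) θ
      (Pi.single a 1) (Pi.single b 1)) := by
  have hw : ∀ n ∈ cluster c m, projPt (x n) ≠ 0 := fun n _ =>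
    ne_zero_of_mem_unit_sphere (projPt_mem_sphere _)
  have h1 : (fun η : Param r =>
      fderiv ℝ (fun ζ : Param r => Real.log (clusterLik x c m ν ζ)) η (Pi.single b 1)) =ᶠ[𝓝 θ]
      fun η => fderiv ℝ (clusterProjLog x c m ν) η (Pi.single b 1) := by
    -- The splitting into offset and `clusterProjLog` is proved only for positive definite scatter
    -- matrices, so the inner derivative needs it on a neighborhood of each η near θ.
    filter_upwards [hθ.eventually_nhds] with η hη
    have h2 : (fun ζ : Param r => Real.log (clusterLik x c m ν ζ)) =ᶠ[𝓝 η]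
        fun ζ => clusterOffset x c m ν + clusterProjLog x c m ν ζ := by
      filter_upwards [hη] with ζ hζ
      exact log_clusterLik_eq hν hc hζ
    rw [h2.fderiv_eq, fderiv_const_add]
  have h3 := (hasFDerivAt_fderiv_sumProjLog hν hw hθ).differentiableAt.hasFDerivAt
  have h4 := h3.clm_apply (hasFDerivAt_const (Pi.single b (1 : ℝ) : Param r) θ)
  rw [fisher, Matrix.of_apply, h1.fderiv_eq]
  have h5 := h4.fderiv
  change fderiv ℝ (fun η => fderiv ℝ (clusterProjLog x c m ν) η (Pi.single b 1)) θ = _ at h5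
  rw [h5]
  simp
  rfl

theorem hessian_le_of_fisher (hν : 0 < ν) (hc : 0 < clusterSize c m) {θ : Param r}
    (hθ : ∀ᶠ η in 𝓝 θ, (scatter η).PosDef) {κ : ℝ}
    (hf : ((1 / (clusterSize c m : ℝ)) • fisher x c m ν θ - κ • 1).PosSemidef) (v : Param r) :
    fderiv ℝ (fun η => fderiv ℝ (clusterProjLog x c m ν) η) θ v v
      ≤ -κ * clusterSize c m * ∑ a, v a ^ 2 := by
  have hc' : (0 : ℝ) < clusterSize c m := Nat.cast_pos.2 hc
  set H := fderiv ℝ (fun η => fderiv ℝ (clusterProjLog x c m ν) η) θ with hH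
  have h1 : H v v = ∑ a, ∑ b, v a * v b * H (Pi.single a 1) (Pi.single b 1) := by
    have hexp : ∀ f : Param r →L[ℝ] ℝ, f v = ∑ a, v a * f (Pi.single a 1) := by
      intro f
      have hv : v = ∑ a, v a • (Pi.single a 1 : Param r) := by
        funext k
        simp [Finset.sum_apply, Pi.single_apply]
      conv_lhs => rw [hv]
      simp only [map_sum, map_smul, smul_eq_mul]
    rw [← ContinuousLinearMap.flip_apply, hexp]
    refine Finset.sum_congr rfl fun a _ => ?_
    rw [ContinuousLinearMap.flip_apply, hexp, Finset.mul_sum]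
    exact Finset.sum_congr rfl fun b _ => by ring
  have h2 := hf.dotProduct_mulVec_nonneg v
  rw [star_trivial, Matrix.sub_mulVec, Matrix.smul_mulVec, Matrix.smul_mulVec, Matrix.one_mulVec,
    dotProduct_sub, dotProduct_smul, dotProduct_smul] at h2
  have h3 : v ⬝ᵥ (fisher x c m ν θ).mulVec v = -H v v := by
    rw [h1]
    simp only [dotProduct, Matrix.mulVec, fisher_eq hν hc hθ, Finset.mul_sum,
      ← Finset.sum_neg_distrib]
    refine Finset.sum_congr rfl fun a _ => Finset.sum_congr rfl fun b _ => ?_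
    rw [hH]
    ring
  have h4 : v ⬝ᵥ v = ∑ a, v a ^ 2 := Finset.sum_congr rfl fun a _ => (sq _).symm
  rw [h3, h4, smul_eq_mul, smul_eq_mul] at h2
  have h5 : κ * (∑ a, v a ^ 2) * clusterSize c m ≤ -H v v := by
    rw [← le_div_iff₀ hc']
    have : 1 / (clusterSize c m : ℝ) * -H v v = -H v v / clusterSize c m := by ring
    linarith
  linarith

end Fisher

/-! ### Uniform likelihood bounds for one candidate model. -/

section Model

variable {r l : ℕ} {ν : Fin l → ℝ} {Ω : Set (Fin l → Param r)}

/-- Varying a single block stays in Ω for small changes, and the other factors of the product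
likelihood cancel; so each block is a local maximum of its own cluster. -/
theorem fderiv_clusterProjLog_eq_zero {N : ℕ} {x : Fin N → Fin r → ℝ} {c : Fin N → Fin l}
    (hν : ∀ m, 0 < ν m) (hc : ∀ m, 0 < clusterSize c m)
    (hpd : ∀ Θ ∈ Ω, ∀ m, (scatter (Θ m)).PosDef) {Θ₀ : Fin l → Param r} (hΩ : Ω ∈ 𝓝 Θ₀)
    (hmax : IsMaxOn (lik x c ν) Ω Θ₀) (m : Fin l) :
    fderiv ℝ (clusterProjLog x c m (ν m)) (Θ₀ m) = 0 := by
  have hΘ₀ : Θ₀ ∈ Ω := mem_of_mem_nhds hΩ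
  refine IsLocalMax.fderiv_eq_zero ?_
  have hcont : ContinuousAt (fun η => Function.update Θ₀ m η) (Θ₀ m) :=
    (continuous_const.update m continuous_id).continuousAt
  have hev : ∀ᶠ η in 𝓝 (Θ₀ m), Function.update Θ₀ m η ∈ Ω :=
    hcont (show Ω ∈ 𝓝 (Function.update Θ₀ m (Θ₀ m)) by rwa [Function.update_eq_self])
  filter_upwards [hev] with η hη
  have h1 : lik x c ν (Function.update Θ₀ m η) ≤ lik x c ν Θ₀ := hmax hη
  have h2 := Real.log_le_log (lik_pos hν hc (hpd _ hη)) h1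
  rw [log_lik hν hc (hpd _ hη), log_lik hν hc (hpd _ hΘ₀), ← sub_nonpos,
    ← Finset.sum_sub_distrib, Finset.sum_eq_single m] at h2
  · have h3 := hpd _ hη m
    rw [Function.update_self] at h2 h3
    rw [log_clusterLik_eq (hν m) (hc m) h3,
      log_clusterLik_eq (hν m) (hc m) (hpd _ hΘ₀ m)] at h2
    linarith
  · intro m' _ hm'
    rw [Function.update_of_ne hm', sub_self]
  · simp

theorem closedBall_eval_subset {K : Set (Fin l → Param r)} {ρ : ℝ} {Θ₀ : Fin l → Param r}
    (hΘ₀ : Θ₀ ∈ K) (hρ : 0 ≤ ρ) (m : Fin l) :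
    Metric.closedBall (Θ₀ m) ρ ⊆ Function.eval m '' Metric.cthickening ρ K := by
  intro η hη
  refine ⟨Function.update Θ₀ m η, Metric.mem_cthickening_of_dist_le _ _ _ _ hΘ₀ ?_, ?_⟩
  · rw [dist_pi_le_iff hρ]
    intro m'
    by_cases h : m' = m
    · subst h
      rwa [Function.update_self]
    · rwa [Function.update_of_ne h, dist_self]
  · simp

theorem exists_pos_forall_le {ι : Type*} [Finite ι] {f : ι → ℝ} (hf : ∀ i, 0 < f i) :
    ∃ ρ, 0 < ρ ∧ ∀ i, ρ ≤ f i := by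
  have h : ∀ᶠ ρ in 𝓝[>] (0 : ℝ), ∀ i, ρ ≤ f i :=
    eventually_all.2 fun i => eventually_nhdsWithin_of_eventually_nhds
      ((eventually_lt_nhds (hf i)).mono fun _ h => h.le)
  obtain ⟨ρ, hρ, hρ'⟩ := (h.and self_mem_nhdsWithin).exists
  exact ⟨ρ, hρ', hρ⟩

variable {x : (N : ℕ) → Fin N → Fin r → ℝ} {c : (N : ℕ) → Fin N → Fin l}
  {Θhat : ℕ → Fin l → Param r}

theorem tendsto_clusterSize {m : Fin l} (hsize : (fun N : ℕ => Real.log N) =o[atTop]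
      fun N : ℕ => (clusterSize (c N) m : ℝ)) :
    Tendsto (fun N => (clusterSize (c N) m : ℝ)) atTop atTop := by
  refine tendsto_atTop_mono' _ ?_ (Real.tendsto_log_atTop.comp tendsto_natCast_atTop_atTop)
  filter_upwards [hsize.bound one_pos] with N hN
  rw [one_mul, Real.norm_eq_abs, Real.norm_eq_abs, Nat.abs_cast] at hN
  exact (le_abs_self _).trans hN

theorem eventually_clusterSize_pos (hsize : ∀ m, (fun N : ℕ => Real.log N) =o[atTop]
      fun N : ℕ => (clusterSize (c N) m : ℝ)) :
    ∀ᶠ N in atTop, ∀ m, 0 < clusterSize (c N) m :=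
  eventually_all.2 fun m => ((tendsto_clusterSize (hsize m)).eventually_gt_atTop 0).mono
    fun _ h => Nat.cast_pos.1 h

/-- The volume scale `∏ N_m^(-q/2)` of a posterior concentrating at rate `N_m^(-1/2)`. -/
def volScale {N : ℕ} (r : ℕ) (c : Fin N → Fin l) : ℝ :=
  ∏ m, (√(clusterSize c m : ℝ) ^ Fintype.card (ParamIx r))⁻¹

theorem volScale_pos {N : ℕ} {c : Fin N → Fin l} (hc : ∀ m, 0 < clusterSize c m) :
    0 < volScale r c := by
  refine Finset.prod_pos fun m _ => ?_
  have : (0 : ℝ) < clusterSize c m := Nat.cast_pos.2 (hc m)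
  positivity

/-- Since N_m ≤ N, the volume scale is at least N^(-ql/2), while log N = o(N_m) makes exp(-κ N_m)
smaller than any fixed power of N. This renders the far region harmless. -/
theorem eventually_exp_neg_le_volScale (hsize : ∀ m, (fun N : ℕ => Real.log N) =o[atTop]
      fun N : ℕ => (clusterSize (c N) m : ℝ)) {κ : ℝ} (hκ : 0 < κ) :
    ∀ᶠ N in atTop, ∀ m, Real.exp (-(κ * clusterSize (c N) m)) ≤ volScale r (c N) := by
  set q := Fintype.card (ParamIx r) with hq
  refine eventually_all.2 fun m => ?_
  -- The added 1 keeps the denominator positive whatever q and l are.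
  have hd : (0 : ℝ) < κ / (q * l + 1) := by positivity
  filter_upwards [(hsize m).bound hd, eventually_clusterSize_pos hsize] with N hN hc
  have hN0 : (0 : ℝ) < N := natCast_pos_of_clusterSize_pos (hc m)
  rw [Real.norm_eq_abs, Real.norm_eq_abs, Nat.abs_cast] at hN
  have h1 : ((√(N : ℝ) ^ q)⁻¹) ^ l ≤ volScale r (c N) := by
    calc ((√(N : ℝ) ^ q)⁻¹) ^ l = ∏ _m : Fin l, (√(N : ℝ) ^ q)⁻¹ := by simp
      _ ≤ volScale r (c N) := by
        refine Finset.prod_le_prod (fun _ _ => by positivity) fun m _ => ?_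
        have : (0 : ℝ) < clusterSize (c N) m := Nat.cast_pos.2 (hc m)
        gcongr
        exact clusterSize_le _ _
  refine le_trans ?_ h1
  have h2 : 0 < ((√(N : ℝ) ^ q)⁻¹) ^ l := by positivity
  rw [← Real.exp_log h2, Real.exp_le_exp, Real.log_pow, Real.log_inv, Real.log_pow,
    Real.log_sqrt hN0.le]
  have h3 : Real.log N ≤ κ / (q * l + 1) * clusterSize (c N) m := (le_abs_self _).trans hN
  have h4 : (q * l : ℝ) * Real.log N ≤ κ * clusterSize (c N) m := by
    rcases le_total 0 (Real.log N) with h5 | h5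
    · calc (q * l : ℝ) * Real.log N ≤ (q * l + 1) * Real.log N := by gcongr; linarith
        _ ≤ (q * l + 1) * (κ / (q * l + 1) * clusterSize (c N) m) := by gcongr
        _ = κ * clusterSize (c N) m := by field_simp
    · exact (mul_nonpos_of_nonneg_of_nonpos (by positivity) h5).trans (by positivity)
  have h5 : 0 ≤ κ * clusterSize (c N) m := by positivity
  have h6 : (l : ℝ) * -(q * (Real.log N / 2)) = -((q * l : ℝ) * Real.log N) / 2 := by ring
  rw [h6]
  linarith

/-- Everything the Laplace argument needs to know about the data: a quadratic upper bound near the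
maximizer, a linear-in-N_m drop away from it, and a quadratic lower bound near it, with constants
common to all clusters and all large N. -/
theorem exists_loglik_bounds (hν : ∀ m, 0 < ν m)
    (hpd : ∀ Θ ∈ Ω, ∀ m, (scatter (Θ m)).PosDef) {K : Set (Fin l → Param r)} {ρ₀ : ℝ}
    (hρ₀ : 0 < ρ₀) (hK : IsCompact K) (hKΩ : Metric.cthickening ρ₀ K ⊆ Ω)
    (hmem : ∀ᶠ N in atTop, Θhat N ∈ K)
    (hmax : ∀ᶠ N in atTop, IsMaxOn (lik (x N) (c N) ν) Ω (Θhat N))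
    {κ : ℝ} (hκ : 0 < κ)
    (hfisher : ∀ᶠ N in atTop, ∀ m, ((1 / (clusterSize (c N) m : ℝ)) •
      fisher (x N) (c N) m (ν m) (Θhat N m) - κ • 1).PosSemidef)
    (hsep : ∀ m, ν m < 1 → ∀ ρ : ℝ, 0 < ρ → ∃ κ : ℝ, 0 < κ ∧ ∀ᶠ N in atTop, ∀ Θ ∈ Ω,
      ρ ≤ dist (Θ m) (Θhat N m) →
        Real.log (clusterLik (x N) (c N) m (ν m) (Θ m)) ≤
          Real.log (clusterLik (x N) (c N) m (ν m) (Θhat N m)) - κ * (clusterSize (c N) m : ℝ))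
    (hsize : ∀ m, (fun N : ℕ => Real.log N) =o[atTop]
      fun N : ℕ => (clusterSize (c N) m : ℝ)) :
    ∃ ρ κ' C : ℝ, 0 < ρ ∧ ρ ≤ ρ₀ ∧ 0 < κ' ∧ 0 < C ∧ ∀ᶠ N in atTop, ∀ m,
      (∀ η, dist η (Θhat N m) ≤ ρ → Real.log (clusterLik (x N) (c N) m (ν m) η) ≤
        Real.log (clusterLik (x N) (c N) m (ν m) (Θhat N m))
          - κ' * clusterSize (c N) m * ∑ a, (η a - Θhat N m a) ^ 2) ∧
      (∀ Θ ∈ Ω, ρ ≤ dist (Θ m) (Θhat N m) →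
        Real.log (clusterLik (x N) (c N) m (ν m) (Θ m)) ≤
        Real.log (clusterLik (x N) (c N) m (ν m) (Θhat N m)) - κ' * clusterSize (c N) m) ∧
      (∀ η, dist η (Θhat N m) ≤ ρ →
        Real.log (clusterLik (x N) (c N) m (ν m) (Θhat N m))
          - C * clusterSize (c N) m * dist η (Θhat N m) ^ 2 ≤
        Real.log (clusterLik (x N) (c N) m (ν m) η)) := by
  set K' : Fin l → Set (Param r) := fun m => Function.eval m '' Metric.cthickening ρ₀ K with hK'
  have hK'c : ∀ m, IsCompact (K' m) := fun m => hK.cthickening.image (continuous_apply m)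
  have hball : ∀ m, ∀ θ ∈ Function.eval m '' K, Metric.closedBall θ ρ₀ ⊆ K' m := by
    rintro m _ ⟨Θ, hΘ, rfl⟩
    exact closedBall_eval_subset hΘ hρ₀.le m
  have hpd' : ∀ m, ∀ θ ∈ K' m, (scatter θ).PosDef := by
    rintro m _ ⟨Θ, hΘ, rfl⟩
    exact hpd Θ (hKΩ hΘ) m
  choose ρ₁ hρ₁ hρ₁' H₁ using fun m =>
    exists_sumProjLog_le (hν m) hρ₀ (hK'c m) (hball m) (hpd' m) hκ
  choose ρ₂ hρ₂ C₂ hC₂ H₂ using fun m =>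
    exists_le_sumProjLog (hν m) hρ₀ (hK'c m) (hball m) (hpd' m)
  obtain ⟨ρ, hρ, hρle⟩ := exists_pos_forall_le
    (f := fun m => min ρ₀ (min (ρ₁ m) (ρ₂ m)))
    fun m => lt_min hρ₀ (lt_min (hρ₁ m) (hρ₂ m))
  have hfar : ∀ m, ∃ κ₃ : ℝ, 0 < κ₃ ∧ ∀ᶠ N in atTop, ν m < 1 → ∀ Θ ∈ Ω,
      min ρ ρ₀ ≤ dist (Θ m) (Θhat N m) →
        Real.log (clusterLik (x N) (c N) m (ν m) (Θ m)) ≤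
          Real.log (clusterLik (x N) (c N) m (ν m) (Θhat N m))
            - κ₃ * (clusterSize (c N) m : ℝ) := by
    intro m
    by_cases h : ν m < 1
    · obtain ⟨κ₃, h1, h2⟩ := hsep m h (min ρ ρ₀) (lt_min hρ hρ₀)
      exact ⟨κ₃, h1, h2.mono fun N hN _ => hN⟩
    · exact ⟨1, one_pos, Eventually.of_forall fun N h' => absurd h' h⟩
  choose κ₃ hκ₃ H₃ using hfar
  obtain ⟨κ₄, hκ₄, hκ₄le⟩ := exists_pos_forall_le hκ₃
  have hρ' : 0 < min ρ ρ₀ := lt_min hρ hρ₀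
  have hC : ∀ m, C₂ m ≤ 1 + ∑ m, C₂ m := fun m => by
    have := Finset.single_le_sum (f := C₂) (fun i _ => (hC₂ i).le) (Finset.mem_univ m)
    linarith
  -- The three rates come from the isolation hypothesis, from the quadratic bound inside the ball,
  -- and from its value on the boundary sphere, which convexity carries outward.
  refine ⟨min ρ ρ₀, min κ₄ (min (κ / 4) (κ / 4 * min ρ ρ₀ ^ 2)), 1 + ∑ m, C₂ m, hρ',
    min_le_right _ _, by positivity,
    add_pos_of_pos_of_nonneg one_pos (Finset.sum_nonneg fun m _ => (hC₂ m).le), ?_⟩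
  filter_upwards [hmem, hmax, hfisher, eventually_clusterSize_pos hsize,
    eventually_all.2 H₃] with N hN hNmax hNf hc hNfar m
  have hin : Ω ∈ 𝓝 (Θhat N) := by
    refine mem_of_superset (Metric.closedBall_mem_nhds _ hρ₀) fun Θ hΘ => hKΩ ?_
    exact Metric.mem_cthickening_of_dist_le _ _ _ _ hN hΘ
  have hθK : Θhat N m ∈ Function.eval m '' K := ⟨_, hN, rfl⟩
  have hev := eventually_posDef_of_closedBall_subset hρ₀ (hpd' m) (hball m _ hθK)
  have hθ := hev.self_of_nhds
  have hw : ∀ n ∈ cluster (c N) m, projPt (x N n) ∈ Metric.sphere (0 : (Fin r → ℝ) × ℝ) 1 :=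
    fun n _ => projPt_mem_sphere _
  have hcrit := fderiv_clusterProjLog_eq_zero hν hc hpd hin hNmax m
  have hhess := hessian_le_of_fisher (hν m) (hc m) hev (hNf m)
  have hle₁ : min ρ ρ₀ ≤ ρ₁ m := (min_le_left _ _).trans <| (hρle m).trans <|
    (min_le_right _ _).trans (min_le_left _ _)
  have hle₂ : min ρ ρ₀ ≤ ρ₂ m := (min_le_left _ _).trans <| (hρle m).trans <|
    (min_le_right _ _).trans (min_le_right _ _)
  have hnear := H₁ m (Fin N) (cluster (c N) m) (fun n => projPt (x N n)) hw _ hθK hcrit hhess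
  have hlow := H₂ m (Fin N) (cluster (c N) m) (fun n => projPt (x N n)) hw _ hθK hcrit
  have hpdball : ∀ η, dist η (Θhat N m) ≤ min ρ ρ₀ → (scatter η).PosDef := fun η hη =>
    hpd' m η (hball m _ hθK (hη.trans (min_le_right _ _)))
  have hloghat := log_clusterLik_eq (x := x N) (hν m) (hc m) hθ
  have hNm : (0 : ℝ) < clusterSize (c N) m := Nat.cast_pos.2 (hc m)
  refine ⟨fun η hη => ?_, fun Θ hΘ hd => ?_, fun η hη => ?_⟩
  · rw [hloghat, log_clusterLik_eq (hν m) (hc m) (hpdball η hη)]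
    have h := hnear (η - Θhat N m) (by rw [← dist_eq_norm]; exact hη.trans hle₁)
    rw [add_sub_cancel] at h
    have h2 : min κ₄ (min (κ / 4) (κ / 4 * min ρ ρ₀ ^ 2)) * (clusterSize (c N) m : ℝ)
        * ∑ a, (η a - Θhat N m a) ^ 2 ≤
        κ / 4 * (clusterSize (c N) m : ℝ) * ∑ a, (η a - Θhat N m a) ^ 2 := by
      have : 0 ≤ ∑ a, (η a - Θhat N m a) ^ 2 := Finset.sum_nonneg fun _ _ => sq_nonneg _
      gcongr
      exact (min_le_right _ _).trans (min_le_left _ _)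
    change clusterProjLog _ _ _ _ _ ≤ clusterProjLog _ _ _ _ _ -
      κ / 4 * (clusterSize (c N) m : ℝ) * ∑ a, (η a - Θhat N m a) ^ 2 at h
    linarith
  · by_cases hν1 : ν m < 1
    · have h := hNfar m hν1 Θ hΘ hd
      have h2 : min κ₄ (min (κ / 4) (κ / 4 * min ρ ρ₀ ^ 2)) * (clusterSize (c N) m : ℝ) ≤
          κ₃ m * clusterSize (c N) m := by
        gcongr
        exact (min_le_left _ _).trans (hκ₄le m)
      linarith
    · rw [hloghat, log_clusterLik_eq (hν m) (hc m) (hpd Θ hΘ m)]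
      have h := sumProjLog_le_of_le_dist (s := cluster (c N) m) (w := fun n => projPt (x N n))
        (not_lt.1 hν1) (fun n hn => ne_zero_of_mem_unit_sphere (hw n hn)) hθ (hpd Θ hΘ m)
        hcrit hρ'.le (b := clusterProjLog (x N) (c N) m (ν m) (Θhat N m)
          - κ / 4 * min ρ ρ₀ ^ 2 * clusterSize (c N) m) (fun h hh => ?_) hd
      · change clusterProjLog _ _ _ _ _ ≤ _ at h
        have h2 : min κ₄ (min (κ / 4) (κ / 4 * min ρ ρ₀ ^ 2)) * (clusterSize (c N) m : ℝ) ≤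
            κ / 4 * min ρ ρ₀ ^ 2 * clusterSize (c N) m := by
          gcongr
          exact (min_le_right _ _).trans (min_le_right _ _)
        linarith
      · refine (hnear h (hh.le.trans hle₁)).trans ?_
        have h3 := sq_norm_le_sum_sq h
        rw [hh] at h3
        have h4 : κ / 4 * min ρ ρ₀ ^ 2 * clusterSize (c N) m ≤
            κ / 4 * (cluster (c N) m).card * ∑ a, h a ^ 2 := by
          rw [mul_right_comm]
          change κ / 4 * (clusterSize (c N) m : ℝ) * _ ≤ κ / 4 * (clusterSize (c N) m : ℝ) * _
          gcongr
        exact sub_le_sub_left h4 _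
  · rw [hloghat, log_clusterLik_eq (hν m) (hc m) (hpdball η hη)]
    have h := hlow (η - Θhat N m) (by rw [← dist_eq_norm]; exact hη.trans hle₂)
    rw [add_sub_cancel, ← dist_eq_norm] at h
    change clusterProjLog _ _ _ _ _ - C₂ m * (clusterSize (c N) m : ℝ) * _ ≤
      clusterProjLog _ _ _ _ _ at h
    have h2 : C₂ m * (clusterSize (c N) m : ℝ) * dist η (Θhat N m) ^ 2 ≤
        (1 + ∑ m, C₂ m) * (clusterSize (c N) m : ℝ) * dist η (Θhat N m) ^ 2 := by
      gcongr
      exact hC m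
    linarith

end Model

/-! ### Two-sided bounds for the evidence. -/

section Evidence

open MeasureTheory

variable {r l N : ℕ} {x : Fin N → Fin r → ℝ} {c : Fin N → Fin l} {ν : Fin l → ℝ}
  {Ω : Set (Fin l → Param r)} {prior : (Fin l → Param r) → ℝ} {Θ₀ : Fin l → Param r}

theorem le_mul_exp_neg_of_log_le {a b t : ℝ} (ha : 0 < a) (hb : 0 < b)
    (h : Real.log a ≤ Real.log b - t) : a ≤ b * Real.exp (-t) := by
  rw [← Real.log_le_log_iff ha (by positivity), Real.log_mul hb.ne' (Real.exp_pos _).ne',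
    Real.log_exp]
  linarith

theorem mul_exp_neg_le_of_le_log {a b t : ℝ} (ha : 0 < a) (hb : 0 < b)
    (h : Real.log b - t ≤ Real.log a) : b * Real.exp (-t) ≤ a := by
  rw [← Real.log_le_log_iff (by positivity) ha, Real.log_mul hb.ne' (Real.exp_pos _).ne',
    Real.log_exp]
  linarith

theorem continuousOn_lik (hν : ∀ m, 0 < ν m) (hc : ∀ m, 0 < clusterSize c m)
    (hpd : ∀ Θ ∈ Ω, ∀ m, (scatter (Θ m)).PosDef) : ContinuousOn (lik x c ν) Ω := by
  have h : ContinuousOn (fun Θ : Fin l → Param r => Real.exp (∑ m,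
      (clusterOffset x c m (ν m) + clusterProjLog x c m (ν m) (Θ m)))) Ω := by
    refine Real.continuous_exp.comp_continuousOn ?_
    refine continuousOn_finsetSum _ fun m _ => continuousOn_const.add ?_
    intro Θ hΘ
    have h1 := (hasFDerivAt_sumProjLog (s := cluster c m) (w := fun n => projPt (x n)) (hν m)
      (fun n _ => ne_zero_of_mem_unit_sphere (projPt_mem_sphere _)) (hpd Θ hΘ m)).continuousAt
    exact (ContinuousAt.comp (f := fun Θ : Fin l → Param r => Θ m) h1
      (continuous_apply m).continuousAt).continuousWithinAt
  refine h.congr fun Θ hΘ => ?_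
  rw [← Real.exp_log (lik_pos (x := x) hν hc (hpd Θ hΘ)), log_lik hν hc (hpd Θ hΘ)]
  congr 1
  exact Finset.sum_congr rfl fun m _ => log_clusterLik_eq (hν m) (hc m) (hpd Θ hΘ m)

/-- The likelihood is continuous on Ω and bounded there by its maximum, so integrability is
inherited from the prior. -/
theorem integrableOn_prior_mul_lik (hν : ∀ m, 0 < ν m) (hc : ∀ m, 0 < clusterSize c m)
    (hΩ : MeasurableSet Ω) (hpd : ∀ Θ ∈ Ω, ∀ m, (scatter (Θ m)).PosDef)
    (hint : IntegrableOn prior Ω) (hmax : IsMaxOn (lik x c ν) Ω Θ₀) :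
    IntegrableOn (fun Θ => prior Θ * lik x c ν Θ) Ω := by
  refine Integrable.mul_bdd (c := lik x c ν Θ₀) hint
    ((continuousOn_lik hν hc hpd).aestronglyMeasurable hΩ) ?_
  filter_upwards [ae_restrict_mem hΩ] with Θ hΘ
  rw [Real.norm_eq_abs, abs_of_pos (lik_pos hν hc (hpd Θ hΘ))]
  exact hmax hΘ

/-- Used with d = √(π/κ) for the Gaussian integral of the upper bound and with d = 2 for the cube
volume of the lower bound. -/
theorem volScale_mul_pow (d : ℝ) :
    ∏ m, (d / √(clusterSize c m : ℝ)) ^ Fintype.card (ParamIx r) =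
      volScale r c * d ^ (Fintype.card (ParamIx r) * l) := by
  have h : ∀ m, (d / √(clusterSize c m : ℝ)) ^ Fintype.card (ParamIx r) =
      (√(clusterSize c m : ℝ) ^ Fintype.card (ParamIx r))⁻¹ *
        d ^ Fintype.card (ParamIx r) := fun m => by
    rw [div_pow, div_eq_mul_inv, mul_comm]
  rw [Finset.prod_congr rfl fun m _ => h m, Finset.prod_mul_distrib, volScale]
  simp [pow_mul]

theorem lik_le_mul_gaussian (hν : ∀ m, 0 < ν m) (hc : ∀ m, 0 < clusterSize c m)
    (hΘ₀ : ∀ m, (scatter (Θ₀ m)).PosDef) {κ : ℝ} {Θ : Fin l → Param r}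
    (hΘ : ∀ m, (scatter (Θ m)).PosDef)
    (hnear : ∀ m, Real.log (clusterLik x c m (ν m) (Θ m)) ≤
        Real.log (clusterLik x c m (ν m) (Θ₀ m))
          - κ * clusterSize c m * ∑ a, (Θ m a - Θ₀ m a) ^ 2) :
    lik x c ν Θ ≤ lik x c ν Θ₀ *
      ∏ m, ∏ a, Real.exp (-(κ * clusterSize c m) * (Θ m a - Θ₀ m a) ^ 2) := by
  rw [lik, lik, ← Finset.prod_mul_distrib]
  refine Finset.prod_le_prod (fun m _ => (clusterLik_pos (hν m) (hc m) (hΘ m)).le) fun m _ => ?_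
  have h := le_mul_exp_neg_of_log_le (clusterLik_pos (hν m) (hc m) (hΘ m))
    (clusterLik_pos (hν m) (hc m) (hΘ₀ m)) (hnear m)
  rwa [← neg_mul, Finset.mul_sum, Real.exp_sum] at h

/-- One cluster far from its estimate suffices, because no other cluster can gain. -/
theorem lik_le_mul_exp (hν : ∀ m, 0 < ν m) (hc : ∀ m, 0 < clusterSize c m)
    (hΘ₀ : ∀ m, (scatter (Θ₀ m)).PosDef) {t : ℝ} {Θ : Fin l → Param r}
    (hΘ : ∀ m, (scatter (Θ m)).PosDef)
    (hle : ∀ m, Real.log (clusterLik x c m (ν m) (Θ m)) ≤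
        Real.log (clusterLik x c m (ν m) (Θ₀ m))) {m₀ : Fin l}
    (hm₀ : Real.log (clusterLik x c m₀ (ν m₀) (Θ m₀)) ≤
        Real.log (clusterLik x c m₀ (ν m₀) (Θ₀ m₀)) - t) :
    lik x c ν Θ ≤ lik x c ν Θ₀ * Real.exp (-t) := by
  refine le_mul_exp_neg_of_log_le (lik_pos hν hc hΘ) (lik_pos hν hc hΘ₀) ?_
  rw [log_lik hν hc hΘ, log_lik hν hc hΘ₀, ← Finset.add_sum_erase _ _ (Finset.mem_univ m₀),
    ← Finset.add_sum_erase _ _ (Finset.mem_univ m₀)]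
  have := Finset.sum_le_sum fun m (_ : m ∈ Finset.univ.erase m₀) => hle m
  linarith

/-- The integrand is dominated by a Gaussian when all blocks are near, and by an exponentially small
multiple of the prior otherwise. Both majorants are nonnegative, so their sum dominates everywhere
and the integral need not be split. -/
theorem evidence_le (hν : ∀ m, 0 < ν m) (hc : ∀ m, 0 < clusterSize c m)
    (hΩ : MeasurableSet Ω) (hpd : ∀ Θ ∈ Ω, ∀ m, (scatter (Θ m)).PosDef)
    (hnonneg : ∀ Θ ∈ Ω, 0 ≤ prior Θ) (hint : IntegrableOn prior Ω)
    (hone : ∫ Θ in Ω, prior Θ = 1) (hΘ₀ : Θ₀ ∈ Ω) (hmax : IsMaxOn (lik x c ν) Ω Θ₀)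
    {ρ κ b : ℝ} (hκ : 0 < κ) (hb : 0 ≤ b)
    (hprior : ∀ Θ, (∀ m, dist (Θ m) (Θ₀ m) ≤ ρ) → prior Θ ≤ b)
    (hnear : ∀ m η, dist η (Θ₀ m) ≤ ρ → Real.log (clusterLik x c m (ν m) η) ≤
        Real.log (clusterLik x c m (ν m) (Θ₀ m))
          - κ * clusterSize c m * ∑ a, (η a - Θ₀ m a) ^ 2)
    (hfar : ∀ m, ∀ Θ ∈ Ω, ρ ≤ dist (Θ m) (Θ₀ m) →
        Real.log (clusterLik x c m (ν m) (Θ m)) ≤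
        Real.log (clusterLik x c m (ν m) (Θ₀ m)) - κ * clusterSize c m)
    (hexp : ∀ m, Real.exp (-(κ * clusterSize c m)) ≤ volScale r c) :
    evidence x c ν Ω prior ≤ lik x c ν Θ₀ * volScale r c *
      (b * √(Real.pi / κ) ^ (Fintype.card (ParamIx r) * l) + 1) := by
  have hN : ∀ m, (0 : ℝ) < clusterSize c m := fun m => Nat.cast_pos.2 (hc m)
  have hL := lik_pos (x := x) hν hc (hpd Θ₀ hΘ₀)
  set G : (Fin l → Param r) → ℝ := fun Θ =>
    ∏ m, ∏ a, Real.exp (-(κ * clusterSize c m) * (Θ m a - Θ₀ m a) ^ 2) with hG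
  have hGi : Integrable G := integrable_prod_gaussian _ (fun m => mul_pos hκ (hN m)) Θ₀
  have hG0 : ∀ Θ, 0 ≤ G Θ := fun Θ =>
    Finset.prod_nonneg fun m _ => Finset.prod_nonneg fun a _ => (Real.exp_pos _).le
  have hGint : ∫ Θ, G Θ = volScale r c * √(Real.pi / κ) ^ (Fintype.card (ParamIx r) * l) := by
    rw [hG, integral_prod_gaussian, ← volScale_mul_pow]
    refine Finset.prod_congr rfl fun m _ => ?_
    rw [← Real.sqrt_div (by positivity), div_div]
  have hV := volScale_pos (r := r) hc
  have hpt : ∀ Θ ∈ Ω, prior Θ * lik x c ν Θ ≤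
      lik x c ν Θ₀ * b * G Θ + lik x c ν Θ₀ * volScale r c * prior Θ := by
    intro Θ hΘ
    have hp := hnonneg Θ hΘ
    by_cases hd : ∀ m, dist (Θ m) (Θ₀ m) ≤ ρ
    · have h1 := lik_le_mul_gaussian hν hc (hpd Θ₀ hΘ₀) (hpd Θ hΘ)
        fun m => hnear m (Θ m) (hd m)
      calc prior Θ * lik x c ν Θ ≤ b * (lik x c ν Θ₀ * G Θ) :=
            mul_le_mul (hprior Θ hd) h1 (lik_pos hν hc (hpd Θ hΘ)).le hb
        _ = lik x c ν Θ₀ * b * G Θ := by ring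
        _ ≤ _ := le_add_of_nonneg_right (by positivity)
    · push Not at hd
      obtain ⟨m₀, hm₀⟩ := hd
      have h1 := lik_le_mul_exp (Θ := Θ) hν hc (hpd Θ₀ hΘ₀) (hpd Θ hΘ) (fun m => ?_)
        (hfar m₀ Θ hΘ hm₀.le)
      · calc prior Θ * lik x c ν Θ ≤ prior Θ * (lik x c ν Θ₀ * volScale r c) := by
              gcongr
              refine h1.trans ?_
              gcongr
              exact hexp m₀
          _ = lik x c ν Θ₀ * volScale r c * prior Θ := by ring
          _ ≤ _ := le_add_of_nonneg_left (mul_nonneg (mul_nonneg hL.le hb) (hG0 Θ))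
      · rcases le_total (dist (Θ m) (Θ₀ m)) ρ with h | h
        · refine (hnear m _ h).trans (sub_le_self _ ?_)
          have := Finset.sum_nonneg fun a (_ : a ∈ Finset.univ) => sq_nonneg (Θ m a - Θ₀ m a)
          have := hN m
          positivity
        · have := hN m
          exact (hfar m Θ hΘ h).trans (sub_le_self _ (by positivity))
  calc evidence x c ν Ω prior
      ≤ ∫ Θ in Ω, (lik x c ν Θ₀ * b * G Θ + lik x c ν Θ₀ * volScale r c * prior Θ) :=
        setIntegral_mono_on (integrableOn_prior_mul_lik hν hc hΩ hpd hint hmax)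
          ((hGi.integrableOn.const_mul _).add (hint.const_mul _)) hΩ hpt
    _ = lik x c ν Θ₀ * b * (∫ Θ in Ω, G Θ) + lik x c ν Θ₀ * volScale r c := by
        rw [integral_add (hGi.integrableOn.const_mul _) (hint.const_mul _), integral_const_mul,
          integral_const_mul, hone, mul_one]
    _ ≤ lik x c ν Θ₀ * b * (∫ Θ, G Θ) + lik x c ν Θ₀ * volScale r c := by
        have := setIntegral_le_integral (s := Ω) hGi (Eventually.of_forall hG0)
        exact add_le_add (mul_le_mul_of_nonneg_left this (mul_nonneg hL.le hb)) le_rfl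
    _ = _ := by rw [hGint]; ring

/-- On the product of balls of radius N_m^(-1/2) each cluster loses at most a factor exp(-C). In the
sup norm these balls are cubes, of volume (2/√N_m)^q. -/
theorem le_evidence (hν : ∀ m, 0 < ν m) (hc : ∀ m, 0 < clusterSize c m)
    (hΩ : MeasurableSet Ω) (hpd : ∀ Θ ∈ Ω, ∀ m, (scatter (Θ m)).PosDef)
    (hnonneg : ∀ Θ ∈ Ω, 0 ≤ prior Θ) (hint : IntegrableOn prior Ω)
    (hΘ₀ : Θ₀ ∈ Ω) (hmax : IsMaxOn (lik x c ν) Ω Θ₀)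
    {ρ C b : ℝ}
    (hsub : ∀ Θ, (∀ m, dist (Θ m) (Θ₀ m) ≤ ρ) → Θ ∈ Ω)
    (hprior : ∀ Θ, (∀ m, dist (Θ m) (Θ₀ m) ≤ ρ) → b ≤ prior Θ)
    (hlow : ∀ m η, dist η (Θ₀ m) ≤ ρ → Real.log (clusterLik x c m (ν m) (Θ₀ m))
        - C * clusterSize c m * dist η (Θ₀ m) ^ 2 ≤ Real.log (clusterLik x c m (ν m) η))
    (hC : 0 ≤ C) (hsmall : ∀ m, (√(clusterSize c m : ℝ))⁻¹ ≤ ρ) :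
    lik x c ν Θ₀ * volScale r c *
      (b * Real.exp (-(C * l)) * 2 ^ (Fintype.card (ParamIx r) * l)) ≤
        evidence x c ν Ω prior := by
  have hN : ∀ m, (0 : ℝ) < clusterSize c m := fun m => Nat.cast_pos.2 (hc m)
  have hL := lik_pos (x := x) hν hc (hpd Θ₀ hΘ₀)
  set B : Set (Fin l → Param r) := Set.univ.pi fun m =>
    Metric.closedBall (Θ₀ m) (√(clusterSize c m : ℝ))⁻¹ with hB
  have hBm : ∀ Θ ∈ B, ∀ m, dist (Θ m) (Θ₀ m) ≤ (√(clusterSize c m : ℝ))⁻¹ := fun Θ hΘ m =>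
    hΘ m (Set.mem_univ m)
  have hBρ : ∀ Θ ∈ B, ∀ m, dist (Θ m) (Θ₀ m) ≤ ρ := fun Θ hΘ m =>
    (hBm Θ hΘ m).trans (hsmall m)
  have hBmeas : MeasurableSet B := MeasurableSet.univ_pi fun m => measurableSet_closedBall
  have hBΩ : B ⊆ Ω := fun Θ hΘ => hsub Θ (hBρ Θ hΘ)
  have hvol : volume.real B = volScale r c * 2 ^ (Fintype.card (ParamIx r) * l) := by
    rw [← volScale_mul_pow, measureReal_def, hB, volume_pi_pi, ENNReal.toReal_prod]
    refine Finset.prod_congr rfl fun m _ => ?_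
    have : 0 ≤ (√(clusterSize c m : ℝ))⁻¹ := by positivity
    rw [Real.volume_pi_closedBall _ this, ENNReal.toReal_ofReal (by positivity), div_eq_mul_inv]
  have hBfin : volume B ≠ ⊤ := by
    rw [hB, volume_pi_pi]
    exact ENNReal.prod_ne_top fun m _ => measure_closedBall_lt_top.ne
  have hlik : ∀ Θ ∈ B, lik x c ν Θ₀ * Real.exp (-(C * l)) ≤ lik x c ν Θ := by
    intro Θ hΘ
    have hΘ' := hpd Θ (hBΩ hΘ)
    refine mul_exp_neg_le_of_le_log (lik_pos hν hc hΘ') hL ?_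
    rw [log_lik hν hc hΘ', log_lik hν hc (hpd Θ₀ hΘ₀)]
    have h1 : C * l = ∑ _m : Fin l, C := by simp [mul_comm]
    rw [h1, ← Finset.sum_sub_distrib]
    refine Finset.sum_le_sum fun m _ => le_trans (sub_le_sub_left ?_ _)
      (hlow m (Θ m) (hBρ Θ hΘ m))
    have h2 : dist (Θ m) (Θ₀ m) ^ 2 ≤ (clusterSize c m : ℝ)⁻¹ := by
      calc _ ≤ ((√(clusterSize c m : ℝ))⁻¹) ^ 2 := by gcongr; exact hBm Θ hΘ m
        _ = _ := by rw [inv_pow, Real.sq_sqrt (hN m).le]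
    have := hN m
    calc C * clusterSize c m * dist (Θ m) (Θ₀ m) ^ 2
        ≤ C * clusterSize c m * (clusterSize c m : ℝ)⁻¹ := by gcongr
      _ = C := by field_simp
  have hi := integrableOn_prior_mul_lik hν hc hΩ hpd hint hmax
  calc _ = ∫ _Θ in B, b * (lik x c ν Θ₀ * Real.exp (-(C * l))) := by
        rw [setIntegral_const, hvol, smul_eq_mul]
        ring
    _ ≤ ∫ Θ in B, prior Θ * lik x c ν Θ := by
        refine setIntegral_mono_on (integrableOn_const hBfin) (hi.mono_set hBΩ) hBmeas
          fun Θ hΘ => ?_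
        exact mul_le_mul (hprior Θ (hBρ Θ hΘ)) (hlik Θ hΘ) (by positivity)
          (hnonneg Θ (hBΩ hΘ))
    _ ≤ evidence x c ν Ω prior := by
        refine setIntegral_mono_set hi ?_ hBΩ.eventuallyLE
        filter_upwards [ae_restrict_mem hΩ] with Θ hΘ
        exact mul_nonneg (hnonneg Θ hΘ) (lik_pos hν hc (hpd Θ hΘ)).le

end Evidence

/-! ### The evidence in terms of the criterion. -/

section Criterion

variable {r l : ℕ} {ν : Fin l → ℝ}

/-- Unordered pairs with repetition number (r + 1) choose 2. -/
theorem card_paramIx (r : ℕ) : (Fintype.card (ParamIx r) : ℝ) = numParams r := by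
  have h : Fintype.card (Sym2 (Fin r)) = (r + 1).choose 2 := by
    rw [← Nat.card_eq_fintype_card, Sym2.natCard, Nat.card_fin]
  rw [Fintype.card_sum, Fintype.card_fin, h, numParams]
  push_cast
  rw [Nat.cast_choose_two]
  push_cast
  ring

theorem log_volScale {N : ℕ} {c : Fin N → Fin l} (hc : ∀ m, 0 < clusterSize c m) :
    Real.log (volScale r c) = -(numParams r / 2) * ∑ m, Real.log (clusterSize c m) := by
  have hN : ∀ m, (0 : ℝ) < clusterSize c m := fun m => Nat.cast_pos.2 (hc m)
  rw [volScale, Real.log_prod fun m _ => by have := hN m; positivity, Finset.mul_sum]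
  refine Finset.sum_congr rfl fun m _ => ?_
  rw [Real.log_inv, Real.log_pow, Real.log_sqrt (hN m).le, card_paramIx]
  ring

/-- The bound depends only on r and ν, so the penalty may use ε_m in place of N_m. -/
theorem sum_log_eps_bounds {N : ℕ} {x : Fin N → Fin r → ℝ} {c : Fin N → Fin l}
    (hν : ∀ m, 0 < ν m) (hc : ∀ m, 0 < clusterSize c m) {Θ : Fin l → Param r}
    (hΘ : ∀ m, (scatter (Θ m)).PosDef) :
    |∑ m, Real.log (eps x c m (ν m) (Θ m)) - ∑ m, Real.log (clusterSize c m)| ≤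
      ∑ m, Real.log (((ν m + r) / ν m) ^ 2) := by
  have hN : ∀ m, (0 : ℝ) < clusterSize c m := fun m => Nat.cast_pos.2 (hc m)
  have h0 : ∀ m, Real.log (clusterSize c m) ≤ Real.log (eps x c m (ν m) (Θ m)) := fun m =>
    Real.log_le_log (hN m) (eps_bounds (hν m) (hΘ m)).1
  rw [← Finset.sum_sub_distrib,
    abs_of_nonneg (Finset.sum_nonneg fun m _ => sub_nonneg.2 (h0 m))]
  refine Finset.sum_le_sum fun m _ => ?_
  have h1 := eps_bounds (x := x) (c := c) (m := m) (hν m) (hΘ m)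
  have h2 : 0 < (ν m + r) / ν m := by have := hν m; positivity
  have h3 := Real.log_le_log ((hN m).trans_le h1.1) h1.2
  rw [Real.log_mul (by positivity) (hN m).ne'] at h3
  linarith

open MeasureTheory in
/-- The evidence of one model is positive and given by the criterion up to a bounded factor. -/
theorem exists_abs_log_evidence_sub_le (hν : ∀ m, 0 < ν m)
    {x : (N : ℕ) → Fin N → Fin r → ℝ} {c : (N : ℕ) → Fin N → Fin l}
    {Ω : Set (Fin l → Param r)} (hΩ : MeasurableSet Ω)
    (hpd : ∀ Θ ∈ Ω, ∀ m, (scatter (Θ m)).PosDef) {prior : (Fin l → Param r) → ℝ}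
    (hnonneg : ∀ Θ ∈ Ω, 0 ≤ prior Θ) (hcont : ContinuousOn prior Ω)
    (hint : IntegrableOn prior Ω) (hone : ∫ Θ in Ω, prior Θ = 1)
    {Θhat : ℕ → Fin l → Param r}
    (hmax : ∀ᶠ N in atTop, IsMaxOn (lik (x N) (c N) ν) Ω (Θhat N))
    (hcompact : ∃ K : Set (Fin l → Param r), IsCompact K ∧ K ⊆ interior Ω ∧
      (∀ Θ ∈ K, 0 < prior Θ) ∧ ∀ᶠ N in atTop, Θhat N ∈ K)
    (hfisher : ∃ κ : ℝ, 0 < κ ∧ ∀ᶠ N in atTop, ∀ m, ((1 / (clusterSize (c N) m : ℝ)) •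
      fisher (x N) (c N) m (ν m) (Θhat N m) - κ • 1).PosSemidef)
    (hsep : ∀ m, ν m < 1 → ∀ ρ : ℝ, 0 < ρ → ∃ κ : ℝ, 0 < κ ∧ ∀ᶠ N in atTop, ∀ Θ ∈ Ω,
      ρ ≤ dist (Θ m) (Θhat N m) →
        Real.log (clusterLik (x N) (c N) m (ν m) (Θ m)) ≤
          Real.log (clusterLik (x N) (c N) m (ν m) (Θhat N m)) - κ * (clusterSize (c N) m : ℝ))
    (hsize : ∀ m, (fun N : ℕ => Real.log N) =o[atTop]
      fun N : ℕ => (clusterSize (c N) m : ℝ)) :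
    ∃ A : ℝ, ∀ᶠ N in atTop,
      Real.log (lik (x N) (c N) ν (Θhat N)) =
        dataFidelity (x N) (c N) ν (Θhat N) - N * Real.log N ∧
      0 < evidence (x N) (c N) ν Ω prior ∧
      |Real.log (evidence (x N) (c N) ν Ω prior)
        - (bicT (x N) (c N) ν (Θhat N) - N * Real.log N)| ≤ A := by
  obtain ⟨K, hK, hKint, hKpos, hKmem⟩ := hcompact
  obtain ⟨κ₀, hκ₀, hf⟩ := hfisher
  -- A closed thickening of K still lies where the prior is positive; being compact, it gives the
  -- prior a positive lower bound b and an upper bound b₂.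
  have hopen : IsOpen (interior Ω ∩ prior ⁻¹' Set.Ioi 0) :=
    (hcont.mono interior_subset).isOpen_inter_preimage isOpen_interior isOpen_Ioi
  obtain ⟨ρ₀, hρ₀, hthick⟩ := hK.exists_cthickening_subset_open hopen
    fun Θ hΘ => ⟨hKint hΘ, hKpos Θ hΘ⟩
  have hKΩ : Metric.cthickening ρ₀ K ⊆ Ω := fun Θ hΘ => interior_subset (hthick hΘ).1
  have hTc : IsCompact (Metric.cthickening ρ₀ K) := hK.cthickening
  obtain ⟨b, hb, hb'⟩ := hTc.exists_forall_le' (hcont.mono hKΩ) fun Θ hΘ => (hthick hΘ).2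
  obtain ⟨b₂, hb₂⟩ := hTc.exists_bound_of_continuousOn (hcont.mono hKΩ)
  obtain ⟨ρ, κ, C, hρ, hρρ₀, hκ, hC, hbounds⟩ := exists_loglik_bounds hν hpd hρ₀ hK hKΩ hKmem
    hmax hκ₀ hf hsep hsize
  have hsmall : ∀ᶠ N in atTop, ∀ m, (√(clusterSize (c N) m : ℝ))⁻¹ ≤ ρ :=
    eventually_all.2 fun m => (tendsto_inv_atTop_zero.comp
      (Real.tendsto_sqrt_atTop.comp (tendsto_clusterSize (hsize m)))).eventually_le_const hρ
  set c₁ := b * Real.exp (-(C * l)) * 2 ^ (Fintype.card (ParamIx r) * l) with hc₁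
  set c₂ := max b₂ 0 * √(Real.pi / κ) ^ (Fintype.card (ParamIx r) * l) + 1 with hc₂
  have hc₁pos : 0 < c₁ := by positivity
  have hc₂pos : 0 < c₂ := by positivity
  have hq : 0 ≤ numParams r := by rw [← card_paramIx]; positivity
  -- The constants of the lower and upper evidence bounds, plus the cost of passing from N_m to ε_m.
  refine ⟨|Real.log c₁| + |Real.log c₂| +
    numParams r / 2 * ∑ m, Real.log (((ν m + r) / ν m) ^ 2), ?_⟩
  filter_upwards [hbounds, hsmall, hmax, hKmem, eventually_clusterSize_pos hsize,
    eventually_exp_neg_le_volScale (r := r) hsize hκ] with N hN hNs hNm hNK hc hexp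
  have hΘ₀ : Θhat N ∈ Ω := interior_subset (hKint hNK)
  have hball : ∀ Θ : Fin l → Param r, (∀ m, dist (Θ m) (Θhat N m) ≤ ρ) →
      Θ ∈ Metric.cthickening ρ₀ K := fun Θ hΘ =>
    Metric.mem_cthickening_of_dist_le _ _ _ _ hNK
      (((dist_pi_le_iff hρ.le).2 hΘ).trans hρρ₀)
  have hupper := evidence_le hν hc hΩ hpd hnonneg hint hone hΘ₀ hNm hκ (le_max_right b₂ 0)
    (fun Θ hΘ => (le_abs_self _).trans ((hb₂ Θ (hball Θ hΘ)).trans (le_max_left _ _)))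
    (fun m => (hN m).1) (fun m => (hN m).2.1) hexp
  have hlower := le_evidence hν hc hΩ hpd hnonneg hint hΘ₀ hNm
    (fun Θ hΘ => hKΩ (hball Θ hΘ)) (fun Θ hΘ => hb' Θ (hball Θ hΘ))
    (fun m => (hN m).2.2) hC.le hNs
  have hL := lik_pos (x := x N) hν hc (hpd _ hΘ₀)
  have hV := volScale_pos (r := r) hc
  rw [← hc₁] at hlower
  rw [← hc₂] at hupper
  have hE : 0 < evidence (x N) (c N) ν Ω prior := lt_of_lt_of_le (by positivity) hlower
  have hloglik := log_lik_eq_dataFidelity_sub (x := x N) hν hc (hpd _ hΘ₀)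
  refine ⟨hloglik, hE, ?_⟩
  have h1 := Real.log_le_log (by positivity) hlower
  have h2 := Real.log_le_log hE hupper
  rw [Real.log_mul (by positivity) hc₁pos.ne', Real.log_mul hL.ne' hV.ne', log_volScale hc] at h1
  rw [Real.log_mul (by positivity) hc₂pos.ne', Real.log_mul hL.ne' hV.ne', log_volScale hc] at h2
  have h3 := mul_le_mul_of_nonneg_left
    (sum_log_eps_bounds (x := x N) hν hc (hpd _ hΘ₀)) (by positivity : 0 ≤ numParams r / 2)
  rw [← abs_of_nonneg (by positivity : 0 ≤ numParams r / 2), ← abs_mul,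
    abs_of_nonneg (by positivity : 0 ≤ numParams r / 2), mul_sub] at h3
  have h4 := abs_le.1 h3
  have h5 := neg_abs_le (Real.log c₁)
  have h6 := le_abs_self (Real.log c₂)
  have h7 := abs_nonneg (Real.log c₁)
  have h8 := abs_nonneg (Real.log c₂)
  rw [hloglik] at h1 h2
  rw [bicT, abs_le]
  constructor <;> linarith

end Criterion

end TBIC

end

/-! ### Bayes' theorem and the conclusion. -/

theorem theorem1 (r : ℕ) (hr : 0 < r) (Lmin Lmax : ℕ) (hLmin : 1 ≤ Lmin)
    -- the data sets `X_N`, and for each candidate model `M_l` a partition of `X_N` into `l` clusters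
    (x : (N : ℕ) → Fin N → Fin r → ℝ)
    (c : (l : Finset.Icc Lmin Lmax) → (N : ℕ) → Fin N → Fin l)
    -- fixed degrees of freedom
    (ν : (l : Finset.Icc Lmin Lmax) → Fin l → ℝ)
    (hν : ∀ (l : Finset.Icc Lmin Lmax) (m : Fin l), 0 < ν l m)
    -- prior on the models
    (p : Finset.Icc Lmin Lmax → ℝ) (hp : ∀ l, 0 < p l) (hp_sum : ∑ l, p l = 1)
    -- parameter spaces, with positive definite scatter matrices, and priors on the parameters
    (Ω : (l : Finset.Icc Lmin Lmax) → Set (Fin l → TBIC.Param r))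
    (hΩ : ∀ l, MeasurableSet (Ω l))
    (hΩ_pd : ∀ l, ∀ Θ ∈ Ω l, ∀ m, (TBIC.scatter (Θ m)).PosDef)
    (prior : (l : Finset.Icc Lmin Lmax) → (Fin l → TBIC.Param r) → ℝ)
    (hprior_nonneg : ∀ l, ∀ Θ ∈ Ω l, 0 ≤ prior l Θ)
    (hprior_cont : ∀ l, ContinuousOn (prior l) (Ω l))
    (hprior_int : ∀ l, MeasureTheory.IntegrableOn (prior l) (Ω l))
    (hprior_one : ∀ l, ∫ Θ in Ω l, prior l Θ = 1)
    -- the parameter estimates maximize the likelihood over the parameter space and stay away from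
    -- its boundary, in a region where the prior is positive
    (Θhat : (l : Finset.Icc Lmin Lmax) → (N : ℕ) → Fin l → TBIC.Param r)
    (hmax : ∀ l : Finset.Icc Lmin Lmax, ∀ᶠ N in atTop, IsMaxOn (TBIC.lik (x N) (c l N) (ν l)) (Ω l) (Θhat l N))
    (hcompact : ∀ l : Finset.Icc Lmin Lmax, ∃ K : Set (Fin l → TBIC.Param r), IsCompact K ∧ K ⊆ interior (Ω l) ∧
      (∀ Θ ∈ K, 0 < prior l Θ) ∧ ∀ᶠ N in atTop, Θhat l N ∈ K)
    -- the normalized observed Fisher information is asymptotically positive definite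
    (hfisher : ∀ l : Finset.Icc Lmin Lmax, ∃ κ : ℝ, 0 < κ ∧ ∀ᶠ N in atTop, ∀ m,
      ((1 / (TBIC.clusterSize (c l N) m : ℝ)) •
        TBIC.fisher (x N) (c l N) m (ν l m) (Θhat l N m) - κ • 1).PosSemidef)
    -- for degrees of freedom below one, where the `t` likelihood may have several local maxima, the
    -- global maximum is asymptotically isolated
    (hsep : ∀ (l : Finset.Icc Lmin Lmax) (m : Fin l), ν l m < 1 → ∀ ρ : ℝ, 0 < ρ → ∃ κ : ℝ, 0 < κ ∧ ∀ᶠ N in atTop, ∀ Θ ∈ Ω l,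
      ρ ≤ dist (Θ m) (Θhat l N m) →
        Real.log (TBIC.clusterLik (x N) (c l N) m (ν l m) (Θ m)) ≤
          Real.log (TBIC.clusterLik (x N) (c l N) m (ν l m) (Θhat l N m))
            - κ * (TBIC.clusterSize (c l N) m : ℝ))
    -- the clusters grow with the data set
    (hsize : ∀ (l : Finset.Icc Lmin Lmax) (m : Fin l), (fun N : ℕ => Real.log N) =o[atTop]
      fun N : ℕ => (TBIC.clusterSize (c l N) m : ℝ)) :
    ∀ l : Finset.Icc Lmin Lmax,
      (∀ᶠ N in atTop, Real.log (TBIC.lik (x N) (c l N) (ν l) (Θhat l N)) =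
        TBIC.dataFidelity (x N) (c l N) (ν l) (Θhat l N) - (N : ℝ) * Real.log N) ∧
      (∀ᶠ N in atTop,
        0 < TBIC.posterior p (x N) (fun l' => c l' N) ν Ω prior l) ∧
      (fun N : ℕ =>
        Real.log (TBIC.posterior p (x N) (fun l' => c l' N) ν Ω prior l)
          - (TBIC.bicT (x N) (c l N) (ν l) (Θhat l N)
              - (N : ℝ) * Real.log N
              - Real.log (TBIC.dataPdf p (x N) (fun l' => c l' N) ν Ω prior)))
        =O[atTop] fun _ : ℕ => (1 : ℝ) := by
  have hkey := fun l : Finset.Icc Lmin Lmax =>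
    TBIC.exists_abs_log_evidence_sub_le (hν l) (hΩ l) (hΩ_pd l) (hprior_nonneg l)
      (hprior_cont l) (hprior_int l) (hprior_one l) (hmax l) (hcompact l) (hfisher l) (hsep l)
      (hsize l)
  choose A hA using hkey
  have hpos : ∀ᶠ N in atTop, 0 < TBIC.dataPdf p (x N) (fun l' => c l' N) ν Ω prior := by
    filter_upwards [eventually_all.2 hA] with N hN
    -- There is a candidate model at all because the prior probabilities sum to one.
    have hne : (Finset.univ : Finset (Finset.Icc Lmin Lmax)).Nonempty := by
      by_contra h
      rw [Finset.not_nonempty_iff_eq_empty] at h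
      rw [h, Finset.sum_empty] at hp_sum
      exact zero_ne_one hp_sum
    exact Finset.sum_pos (fun l _ => mul_pos (hp l) (hN l).2.1) hne
  intro l
  refine ⟨(hA l).mono fun N hN => hN.1, ?_, ?_⟩
  · filter_upwards [hpos, hA l] with N hN hNl
    exact div_pos (mul_pos (hp l) hNl.2.1) hN
  · refine Asymptotics.IsBigO.of_bound (|Real.log (p l)| + A l) ?_
    filter_upwards [hpos, hA l] with N hN hNl
    rw [TBIC.posterior, Real.log_div (mul_pos (hp l) hNl.2.1).ne' hN.ne',
      Real.log_mul (hp l).ne' hNl.2.1.ne', norm_one, mul_one, Real.norm_eq_abs]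
    refine le_trans (le_of_eq ?_) ((abs_add_le (Real.log (p l)) _).trans
      (add_le_add le_rfl hNl.2.2))
    congr 1
    ring
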